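/- Let $q>1$ and $r\in\mathbb{R}$, and write $B_R=\{x\in\mathbb{R}^2:|x|<R\}$. A singular solution of $-\Delta u=f(u)$ on $B_R\setminus\{0\}$ ($R>0$) is a nonnegative function $u\in C^2(B_R\setminus\{0\})$ that satisfies the equation pointwise in $B_R\setminus\{0\}$ and such that $u(x)\to\infty$ as $x\to0$. There exist $R>0$ and a positive, radially symmetric singular solution $u\in C^\infty(B_R\setminus\{0\})$ of $$-\Delta u=u^r e^{u^q}\quad\text{in } B_R\setminus\{0\}$$ satisfying $$u(x)=\bigg(\log\frac1{|x|^2}-\frac{2q+r-1}{q}\log\log\frac1{|x|^2}+\log\frac{4(q-1)}{q^2}\bigg)^{\frac1q}+O\bigg(\frac{\log(-\log|x|)}{(-\log|x|)^{2-\frac1q}}\bigg)\quad\text{as } |x|\to0.$$ For $q=2$, $r=1$ the explicit term and the order of the remainder are, for $0<|x|<1$, respectively $$\big(-2\log|x|-2\log(-\log|x|)-2\log2\big)^{1/2}\quad\text{and}\quad\frac{\log(-\log|x|)}{(-\log|x|)^{3/2}},$$ which are those of the singular solution of $-\Delta u=u(e^{u^2}-1)$ constructed by Ibrahim, Kikuchi,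 Nakanishi and Wei. -/

import Mathlib

open scoped Topology ContDiff Asymptotics

/-- The Euclidean plane. -/
abbrev Plane : Type := EuclideanSpace ℝ (Fin 2)

/-- The punctured disc of radius `R` about the origin. -/
def puncturedDisc (R : ℝ) : Set Plane := Metric.ball 0 R \ {0}

/-- `u` is a singular solution of `-Δu = f(u)` on the punctured disc of radius `R`: it is
nonnegative and of class `C²` there, solves the equation pointwise, and blows up at the origin.
The values of `u` outside the punctured disc play no role. -/
structure IsSingularSolution (f : ℝ → ℝ) (R : ℝ) (u : Plane → ℝ) : Prop where
  radius_pos : 0 < R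
  contDiffOn : ContDiffOn ℝ 2 u (puncturedDisc R)
  nonneg : ∀ x ∈ puncturedDisc R, 0 ≤ u x
  equation : ∀ x ∈ puncturedDisc R, -(Laplacian.laplacian u x) = f (u x)
  tendsto_atTop : Filter.Tendsto u (𝓝[≠] 0) Filter.atTop

/-- The explicit profile
`(log(1/|x|²) - ((2q+r-1)/q) log log(1/|x|²) + log(4(q-1)/q²))^(1/q)`. -/
noncomputable def singularProfile (q r : ℝ) (x : Plane) : ℝ :=
  (Real.log (1 / ‖x‖ ^ 2) - (2 * q + r - 1) / q * Real.log (Real.log (1 / ‖x‖ ^ 2))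
    + Real.log (4 * (q - 1) / q ^ 2)) ^ (1 / q)

/-- The order `log(-log|x|) / (-log|x|)^(2-1/q)` of the remainder. -/
noncomputable def remainderOrder (q : ℝ) (x : Plane) : ℝ :=
  Real.log (-Real.log ‖x‖) / (-Real.log ‖x‖) ^ (2 - 1 / q)

/-! With `s = log (1/|x|²)` and `u x = v s`, the planar equation becomes `v'' = -(1/4) e^{-s} v^r
e^{v^q}`, to be solved near `s = ∞` with prescribed asymptotics.

Put `p = 1/q`. Define `W` by `W + a log W = s + c`, where `a = (2q+r-1)/q` and `c = log
(4(q-1)/q²)`. Then the right-hand side at `v = W^p` is exactly `-p(1-p) W^(p-2)`, which is the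
leading part of `(W^p)''`. Adding `b W^(p-2)` for a suitable `b` removes the next order
(`exists_abs_approxResidual_le`).

Write `v = W^p + b W^(p-2) + η`. Linearising gives `η'' + ((1-p)/s) η = small`, whose solutions
oscillate like `s^(1/4) cos(2 √((1-p) s) + β)`. These waves solve exactly the equation with `3/16
s⁻²` added to the potential, so that term is moved into the perturbation. Variation of parameters in
the basis of waves yields a first-order system whose field is integrable at infinity
(`exists_solution_perturbed_oscillator`). It has a solution tending to zero, found by
Picard–Lindelöf after compactifying time (`exists_integralCurve_decaying_atTop`). The result is `v =
W^p + O(W^(p-1)/s)`.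

One substitution step in `W = s + c - a log W` gives `W = s - a log s + c + O(log s / s)`. Taking
the power `p` produces the explicit profile, with error of order `log s / s^(2-p)`; this step, not
the differential equation, determines the stated remainder. -/

/-! ### Initial value problem at infinite time -/

/-- A globally Lipschitz time-dependent vector field whose Lipschitz constant and size decay
integrably in time has an integral curve that tends to zero at infinite time. -/
theorem exists_integralCurve_decaying_atTop {E : Type*} [NormedAddCommGroup E] [NormedSpace ℝ E]
    [CompleteSpace E] (H : ℝ → E → E) {T K C μ : ℝ} (hT : 1 ≤ T) (hK : 0 ≤ K) (hC : 0 ≤ C)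
    (hμ : 5 / 4 ≤ μ) (hcont : ∀ x, ContinuousOn (fun s => H s x) (Set.Ici T))
    (hlip : ∀ s, T ≤ s → ∀ x y, ‖H s x - H s y‖ ≤ K * s ^ (-(5 / 4) : ℝ) * ‖x - y‖)
    (hbd : ∀ s, T ≤ s → ∀ x, ‖H s x‖ ≤ C * s ^ (-μ)) :
    ∃ Y : ℝ → E, ∀ s, T < s →
      HasDerivAt Y (H s (Y s)) s ∧ ‖Y s‖ ≤ C / (μ - 1) * s ^ (1 - μ) := by
  have hT0 : 0 < T := by linarith
  set ρ₁ : ℝ := T ^ (-(1 / 8) : ℝ) with hρ₁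
  have hρ₁0 : 0 < ρ₁ := Real.rpow_pos_of_pos hT0 _
  have hρ₁1 : ρ₁ ≤ 1 := Real.rpow_le_one_of_one_le_of_nonpos hT (by norm_num)
  have key : ∀ ρ, 0 < ρ → ρ ≤ ρ₁ → T ≤ (ρ⁻¹) ^ 8 := by
    intro ρ h0 h1
    have h2 : ρ ^ 8 ≤ T⁻¹ := by
      calc ρ ^ 8 ≤ ρ₁ ^ 8 := by gcongr
        _ = T⁻¹ := by
          rw [hρ₁, ← Real.rpow_natCast, ← Real.rpow_mul hT0.le, ← Real.rpow_neg_one]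
          norm_num
    rw [inv_pow]
    rw [le_inv_comm₀ hT0 (by positivity)]
    exact h2
  have hpow : ∀ ρ : ℝ, 0 < ρ → ∀ z : ℝ, ((ρ⁻¹) ^ 8) ^ (-z) = ρ ^ (8 * z) := by
    intro ρ h0 z
    rw [← Real.rpow_natCast, ← Real.rpow_mul (by positivity), Real.inv_rpow h0.le,
      ← Real.rpow_neg h0.le]
    congr 1; push_cast; ring
  -- The substitution `s = ρ⁻⁸` brings `s = ∞` to `ρ = 0`. The new field has Lipschitz constant at
  -- most `8Kρ` and size at most `8Cρ^(8μ-9)`, with `8μ - 9 ≥ 1`, so it extends continuously by `0`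
  -- to `ρ = 0`, and the value `0` can be prescribed there.
  set f : ℝ → E → E := fun ρ x => if ρ = 0 then 0 else (-8 * (ρ⁻¹) ^ 9) • H ((ρ⁻¹) ^ 8) x with hf
  have hf0 : ∀ x, f 0 x = 0 := fun x => by simp [hf]
  have hfpos : ∀ ρ, 0 < ρ → ∀ x, f ρ x = (-8 * (ρ⁻¹) ^ 9) • H ((ρ⁻¹) ^ 8) x :=
    fun ρ h x => by simp [hf, h.ne']
  have hfbd : ∀ ρ, 0 ≤ ρ → ρ ≤ ρ₁ → ∀ x, ‖f ρ x‖ ≤ 8 * C * ρ ^ (8 * μ - 9) := by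
    intro ρ h0 h1 x
    rcases h0.eq_or_lt with rfl | h0
    · rw [hf0, norm_zero]; positivity
    · rw [hfpos ρ h0, norm_smul]
      have h2 := hbd _ (key ρ h0 h1) x
      rw [hpow ρ h0] at h2
      have h3 : ‖-8 * (ρ⁻¹) ^ 9‖ = 8 * (ρ⁻¹) ^ 9 := by
        rw [norm_mul, Real.norm_eq_abs, Real.norm_eq_abs, abs_of_pos (by positivity : 0 < (ρ⁻¹) ^ 9)]
        norm_num
      rw [h3, Real.rpow_sub h0]
      calc 8 * (ρ⁻¹) ^ 9 * ‖H ((ρ⁻¹) ^ 8) x‖ ≤ 8 * (ρ⁻¹) ^ 9 * (C * ρ ^ (8 * μ)) := by gcongr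
        _ = 8 * C * (ρ ^ (8 * μ) / ρ ^ (9 : ℝ)) := by
          have : ρ ^ (9 : ℝ) = ρ ^ 9 := by exact_mod_cast Real.rpow_natCast ρ 9
          rw [this]; field_simp
  have hfbd' : ∀ ρ, 0 ≤ ρ → ρ ≤ ρ₁ → ∀ x, ‖f ρ x‖ ≤ 8 * C * ρ := by
    intro ρ h0 h1 x
    refine (hfbd ρ h0 h1 x).trans ?_
    rcases h0.eq_or_lt with rfl | h0
    · rw [Real.zero_rpow (by linarith)]
    · gcongr
      calc ρ ^ (8 * μ - 9) ≤ ρ ^ (1 : ℝ) :=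
            Real.rpow_le_rpow_of_exponent_ge h0 (h1.trans hρ₁1) (by linarith)
        _ = ρ := Real.rpow_one ρ
  have hflip : ∀ ρ, 0 ≤ ρ → ρ ≤ ρ₁ → ∀ x y, ‖f ρ x - f ρ y‖ ≤ 8 * K * ‖x - y‖ := by
    intro ρ h0 h1 x y
    rcases h0.eq_or_lt with rfl | h0
    · rw [hf0, hf0, sub_zero, norm_zero]; positivity
    · rw [hfpos ρ h0, hfpos ρ h0, ← smul_sub, norm_smul]
      have h2 := hlip _ (key ρ h0 h1) x y
      rw [hpow ρ h0] at h2
      have h3 : ‖-8 * (ρ⁻¹) ^ 9‖ = 8 * (ρ⁻¹) ^ 9 := by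
        rw [norm_mul, Real.norm_eq_abs, Real.norm_eq_abs, abs_of_pos (by positivity : 0 < (ρ⁻¹) ^ 9)]
        norm_num
      rw [h3]
      have h4 : ρ ^ (8 * (5 / 4) : ℝ) = ρ ^ 10 := by
        rw [← Real.rpow_natCast]; norm_num
      rw [h4] at h2
      calc _ ≤ 8 * (ρ⁻¹) ^ 9 * (K * ρ ^ 10 * ‖x - y‖) := by gcongr
        _ = 8 * K * ‖x - y‖ * ρ := by field_simp
        _ ≤ 8 * K * ‖x - y‖ * 1 := by gcongr; exact h1.trans hρ₁1
        _ = _ := by ring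
  have hfcont : ∀ x, ContinuousOn (fun ρ => f ρ x) (Set.Icc 0 ρ₁) := by
    intro x ρ hρ
    rcases hρ.1.eq_or_lt with rfl | h0
    · rw [ContinuousWithinAt, hf0]
      refine squeeze_zero_norm' (a := fun ρ => 8 * C * ρ) ?_ ?_
      · filter_upwards [self_mem_nhdsWithin] with ρ h using hfbd' ρ h.1 h.2 x
      · have : Filter.Tendsto (fun ρ : ℝ => 8 * C * ρ) (𝓝 0) (𝓝 (8 * C * 0)) :=
          (continuous_const.mul continuous_id).tendsto 0
        rw [mul_zero] at this
        exact this.mono_left nhdsWithin_le_nhds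
    · have h1 : ContinuousWithinAt (fun ρ : ℝ => (-8 * (ρ⁻¹) ^ 9) • H ((ρ⁻¹) ^ 8) x)
          (Set.Ioc 0 ρ₁) ρ := by
        have hi : ContinuousWithinAt (fun ρ : ℝ => ρ⁻¹) (Set.Ioc 0 ρ₁) ρ :=
          (continuousAt_inv₀ h0.ne').continuousWithinAt
        refine ((continuousWithinAt_const.mul (hi.pow 9))).smul ?_
        exact ContinuousWithinAt.comp (t := Set.Ici T) (g := fun s => H s x)
          (hcont x _ (key ρ h0 hρ.2)) (hi.pow 8) (fun z hz => key z hz.1 hz.2)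
      have h2 : Set.Ioc 0 ρ₁ ∈ 𝓝[Set.Icc 0 ρ₁] ρ := by
        have : Set.Ioi (0 : ℝ) ∈ 𝓝 ρ := Ioi_mem_nhds h0
        filter_upwards [self_mem_nhdsWithin, nhdsWithin_le_nhds this] with z hz hz'
        exact ⟨hz', hz.2⟩
      refine (h1.mono_of_mem_nhdsWithin h2).congr_of_eventuallyEq ?_ (hfpos ρ h0 x)
      filter_upwards [h2] with z hz using hfpos z hz.1 x
  have hPL : IsPicardLindelof f (tmin := 0) (tmax := ρ₁) ⟨0, le_rfl, hρ₁0.le⟩ (0 : E)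
      (⟨8 * C, by positivity⟩) 0 (⟨8 * C, by positivity⟩) (⟨8 * K, by positivity⟩) := by
    refine ⟨fun t ht => ?_, fun x _ => hfcont x, fun t ht x _ => ?_, ?_⟩
    · exact (LipschitzWith.of_dist_le_mul fun x y => by
        rw [dist_eq_norm, dist_eq_norm]; exact hflip t ht.1 ht.2 x y).lipschitzOnWith
    · refine (hfbd' t ht.1 ht.2 x).trans ?_
      have : t ≤ 1 := ht.2.trans hρ₁1
      change 8 * C * t ≤ 8 * C
      nlinarith
    · change 8 * C * max (ρ₁ - 0) (0 - 0) ≤ 8 * C - 0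
      rw [sub_zero, sub_zero, sub_zero, max_eq_left hρ₁0.le]
      nlinarith
  obtain ⟨α, hα0, hα⟩ := hPL.exists_eq_forall_mem_Icc_hasDerivWithinAt₀
  have hα0 : α 0 = 0 := hα0
  have hcα : ContinuousOn α (Set.Icc 0 ρ₁) := fun t ht => (hα t ht).continuousWithinAt
  -- The comparison function is the primitive of `8Cρ^(8μ-9)` vanishing at `0`; in terms of `s` it
  -- is the claimed `s^(1-μ)` decay.
  have hbound : ∀ ρ ∈ Set.Icc 0 ρ₁, ‖α ρ‖ ≤ C / (μ - 1) * ρ ^ (8 * (μ - 1)) := by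
    refine image_norm_le_of_norm_deriv_right_le_deriv_boundary'
      (B := fun ρ => C / (μ - 1) * ρ ^ (8 * (μ - 1)))
      (B' := fun ρ => C / (μ - 1) * (8 * (μ - 1) * ρ ^ (8 * (μ - 1) - 1))) (f' := fun ρ => f ρ (α ρ))
      hcα ?_ ?_ ?_ ?_ ?_
    · intro x hx
      refine (hα x (Set.Ico_subset_Icc_self hx)).mono_of_mem_nhdsWithin ?_
      filter_upwards [self_mem_nhdsWithin, nhdsWithin_le_nhds (Iio_mem_nhds hx.2)] with z h1 h2
      exact ⟨hx.1.trans h1, h2.le⟩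
    · rw [hα0, norm_zero, Real.zero_rpow (by linarith), mul_zero]
    · intro x _
      exact (continuousAt_const.mul
        (Real.continuousAt_rpow_const _ _ (Or.inr (by linarith)))).continuousWithinAt
    · intro x _
      exact ((Real.hasDerivAt_rpow_const (Or.inr (by linarith))).const_mul _).hasDerivWithinAt
    · intro x hx
      refine (hfbd x hx.1 hx.2.le _).trans (le_of_eq ?_)
      have : μ - 1 ≠ 0 := by linarith
      rw [show 8 * (μ - 1) - 1 = 8 * μ - 9 by ring]
      field_simp
  refine ⟨fun s => α (s ^ (-(1 / 8) : ℝ)), fun s hs => ?_⟩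
  have hs0 : 0 < s := hT0.trans hs
  have hρ0 : 0 < s ^ (-(1 / 8) : ℝ) := Real.rpow_pos_of_pos hs0 _
  have hρl : s ^ (-(1 / 8) : ℝ) < ρ₁ := Real.rpow_lt_rpow_of_neg hT0 hs (by norm_num)
  have hrs : ((s ^ (-(1 / 8) : ℝ))⁻¹) ^ 8 = s := by
    rw [← Real.rpow_neg hs0.le, ← Real.rpow_natCast, ← Real.rpow_mul hs0.le]
    norm_num
  constructor
  · have h1 : HasDerivAt α (f _ (α (s ^ (-(1 / 8) : ℝ)))) (s ^ (-(1 / 8) : ℝ)) :=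
      (hα _ ⟨hρ0.le, hρl.le⟩).hasDerivAt (Icc_mem_nhds hρ0 hρl)
    have h2 : HasDerivAt (fun s : ℝ => s ^ (-(1 / 8) : ℝ)) _ s :=
      Real.hasDerivAt_rpow_const (Or.inl hs0.ne')
    have h3 := h1.scomp s h2
    refine h3.congr_deriv ?_
    rw [hfpos _ hρ0, smul_smul, hrs]
    have h4 : (-(1 / 8) * s ^ (-(1 / 8) - 1 : ℝ)) * (-8 * (s ^ (-(1 / 8) : ℝ))⁻¹ ^ 9) = 1 := by
      rw [← Real.rpow_neg hs0.le, ← Real.rpow_natCast, ← Real.rpow_mul hs0.le]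
      rw [show -(1 / 8) * s ^ (-(1 / 8) - 1 : ℝ) * (-8 * s ^ (- -(1 / 8) * ((9 : ℕ) : ℝ)))
        = s ^ (-(1 / 8) - 1 : ℝ) * s ^ (- -(1 / 8) * ((9 : ℕ) : ℝ)) by ring]
      rw [← Real.rpow_add hs0]
      norm_num
    rw [h4, one_smul]
  · refine (hbound _ ⟨hρ0.le, hρl.le⟩).trans (le_of_eq ?_)
    rw [← Real.rpow_mul hs0.le]
    congr 2; ring

/-! ### The implicit profile -/

/-- The inverse `W` of `y ↦ y + a log y - c` near infinity: existence and derivative. -/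
theorem exists_inverse_add_mul_log (a c : ℝ) :
    ∃ W : ℝ → ℝ, Filter.Tendsto W Filter.atTop Filter.atTop ∧
      (∀ᶠ s in Filter.atTop, W s + a * Real.log (W s) = s + c ∧
        HasDerivAt W (W s / (W s + a)) s) := by
  -- Beyond `2|a|` the derivative `1 + a/y` is at least `1/2`, so `γ` expands distances by at least
  -- that factor and its inverse is 2-Lipschitz.
  set y₁ : ℝ := max 1 (2 * |a|) with hy₁
  have hy₁1 : 1 ≤ y₁ := le_max_left _ _
  have hy₁a : 2 * |a| ≤ y₁ := le_max_right _ _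
  set γ : ℝ → ℝ := fun y => y + a * Real.log y with hγ
  have hdγ : ∀ y, y₁ ≤ y → HasDerivAt γ (1 + a * y⁻¹) y := by
    intro y hy
    exact (hasDerivAt_id y).add ((Real.hasDerivAt_log (by linarith)).const_mul a)
  have hcγ : ContinuousOn γ (Set.Ici y₁) := fun y hy => (hdγ y hy).continuousAt.continuousWithinAt
  have hlow : ∀ y, y₁ ≤ y → 1 / 2 ≤ 1 + a * y⁻¹ := by
    intro y hy
    have h0 : 0 < y := by linarith
    have : |a * y⁻¹| ≤ 1 / 2 := by
      rw [abs_mul, abs_of_pos (inv_pos.2 h0), ← div_eq_mul_inv, div_le_iff₀ h0]; linarith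
    linarith [neg_abs_le (a * y⁻¹)]
  have hmono : ∀ y z, y₁ ≤ y → y ≤ z → 1 / 2 * (z - y) ≤ γ z - γ y := by
    intro y z hy hz
    refine (convex_Ici y₁).mul_sub_le_image_sub_of_le_deriv hcγ ?_ ?_ y hy z (hy.trans hz) hz
    · intro x hx
      rw [interior_Ici] at hx
      exact (hdγ x (le_of_lt hx)).differentiableAt.differentiableWithinAt
    · intro x hx
      rw [interior_Ici] at hx
      rw [(hdγ x (le_of_lt hx)).deriv]
      exact hlow x (le_of_lt hx)
  have htop : Filter.Tendsto γ Filter.atTop Filter.atTop := by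
    refine Filter.tendsto_atTop_mono' _ (f₁ := fun z => γ y₁ + 1 / 2 * (z - y₁)) ?_ ?_
    · filter_upwards [Filter.eventually_ge_atTop y₁] with z hz
      linarith [hmono y₁ z le_rfl hz]
    · refine Filter.tendsto_atTop_add_const_left _ _ ?_
      exact (Filter.tendsto_atTop_add_const_right _ (-y₁) Filter.tendsto_id).const_mul_atTop
        (by norm_num)
  have hsurj : ∀ s, γ y₁ ≤ s → ∃ y, y₁ ≤ y ∧ γ y = s := by
    intro s hs
    obtain ⟨z, hz1, hz2⟩ := ((Filter.eventually_ge_atTop y₁).and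
      (htop.eventually_ge_atTop s)).exists
    obtain ⟨y, hy, hys⟩ := intermediate_value_Icc hz1
      (hcγ.mono Set.Icc_subset_Ici_self) ⟨hs, hz2⟩
    exact ⟨y, hy.1, hys⟩
  have hex : ∀ s, ∃ y, γ y₁ - c ≤ s → y₁ ≤ y ∧ γ y = s + c := by
    intro s
    by_cases h : γ y₁ - c ≤ s
    · obtain ⟨y, hy⟩ := hsurj (s + c) (by linarith)
      exact ⟨y, fun _ => hy⟩
    · exact ⟨0, fun h' => absurd h' h⟩
  choose W hW using hex
  have hLip : ∀ s t, γ y₁ - c ≤ s → γ y₁ - c ≤ t → |W s - W t| ≤ 2 * |s - t| := by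
    intro s t hs ht
    obtain ⟨h1, h2⟩ := hW s hs
    obtain ⟨h3, h4⟩ := hW t ht
    rcases le_total (W s) (W t) with h | h
    · have := hmono _ _ h1 h
      rw [abs_sub_comm, abs_of_nonneg (by linarith), abs_sub_comm]
      linarith [le_abs_self (t - s)]
    · have := hmono _ _ h3 h
      rw [abs_of_nonneg (by linarith)]
      linarith [le_abs_self (s - t)]
  refine ⟨W, ?_, ?_⟩
  · refine Filter.tendsto_atTop.2 fun B => ?_
    filter_upwards [Filter.eventually_ge_atTop (γ y₁ - c),
      Filter.eventually_ge_atTop (γ (max B y₁) - c)] with s h1 h2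
    obtain ⟨h3, h4⟩ := hW s h1
    by_contra hlt
    push Not at hlt
    have h5 : W s < max B y₁ := lt_of_lt_of_le hlt (le_max_left _ _)
    linarith [hmono (W s) (max B y₁) h3 h5.le]
  · filter_upwards [Filter.eventually_gt_atTop (γ y₁ - c)] with s hs
    obtain ⟨h1, h2⟩ := hW s hs.le
    refine ⟨h2, ?_⟩
    have hev : ∀ᶠ t in 𝓝 s, γ y₁ - c ≤ t := Ici_mem_nhds hs
    have hcont : ContinuousAt W s := by
      rw [ContinuousAt, tendsto_iff_dist_tendsto_zero]
      have hz : Filter.Tendsto (fun t => 2 * |t - s|) (𝓝 s) (𝓝 0) := by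
        have : Continuous fun t : ℝ => 2 * |t - s| := by fun_prop
        simpa using this.tendsto s
      refine squeeze_zero' (Filter.Eventually.of_forall fun _ => dist_nonneg) ?_ hz
      filter_upwards [hev] with t ht using hLip t s ht hs.le
    have h3 : HasDerivAt (fun y => γ y - c) (1 + a * (W s)⁻¹) (W s) := (hdγ _ h1).sub_const c
    have h0 : 0 < W s := by linarith
    have h4 := hlow _ h1
    have h5 := HasDerivAt.of_local_left_inverse hcont h3 (by linarith)
      (by filter_upwards [hev] with t ht; rw [(hW t ht).2]; ring)
    refine h5.congr_deriv ?_
    have h6 : (1 + a * (W s)⁻¹) = (W s + a) / W s := by field_simp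
    rw [h6, inv_div]

/-- Asymptotic comparison with the identity of a function `W` with `W + a log W = s + c`. -/
theorem eventually_abs_sub_le_of_add_mul_log {a c : ℝ} {W : ℝ → ℝ}
    (hW : Filter.Tendsto W Filter.atTop Filter.atTop)
    (h : ∀ᶠ s in Filter.atTop, W s + a * Real.log (W s) = s + c) :
    ∀ᶠ s in Filter.atTop, |W s - s| ≤ s ^ (1 / 4 : ℝ) ∧ s / 2 ≤ W s ∧ W s ≤ 2 * s := by
  -- The logarithm is absorbed in the power `1/4`, which later makes `1/W - 1/s` of order
  -- `s^(-7/4)`, as the oscillator estimate requires.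
  have h1 : (fun y : ℝ => c - a * Real.log y) =o[Filter.atTop] fun y => y ^ (1 / 4 : ℝ) := by
    refine Asymptotics.IsLittleO.sub ?_ ((isLittleO_log_rpow_atTop (by norm_num)).const_mul_left a)
    exact Asymptotics.isLittleO_const_left.2 (Or.inr
      (tendsto_norm_atTop_atTop.comp (tendsto_rpow_atTop (by norm_num))))
  have h2 := hW.eventually (h1.bound (show (0 : ℝ) < 1 / 4 by norm_num))
  filter_upwards [h, h2, hW.eventually_ge_atTop 1] with s h3 h4 h5
  have h0 : 0 < W s := by linarith
  rw [Real.norm_eq_abs, Real.norm_eq_abs, abs_of_pos (Real.rpow_pos_of_pos h0 (1 / 4))] at h4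
  have h6 : |W s - s| ≤ 1 / 4 * W s ^ (1 / 4 : ℝ) := by
    rwa [show W s - s = c - a * Real.log (W s) by linarith]
  have h7 : W s ^ (1 / 4 : ℝ) ≤ W s := by
    calc W s ^ (1 / 4 : ℝ) ≤ W s ^ (1 : ℝ) :=
          Real.rpow_le_rpow_of_exponent_le h5 (by norm_num)
      _ = W s := Real.rpow_one _
  have h8 := abs_le.1 h6
  have hs : W s ≤ 2 * s := by linarith
  refine ⟨h6.trans ?_, by linarith, hs⟩
  have hs0 : 0 ≤ s := by linarith
  calc 1 / 4 * W s ^ (1 / 4 : ℝ) ≤ 1 / 4 * (2 * s) ^ (1 / 4 : ℝ) := by gcongr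
    _ = 1 / 4 * 2 ^ (1 / 4 : ℝ) * s ^ (1 / 4 : ℝ) := by
      rw [Real.mul_rpow (by norm_num) hs0]; ring
    _ ≤ 1 * s ^ (1 / 4 : ℝ) := by
      gcongr
      have : (2 : ℝ) ^ (1 / 4 : ℝ) ≤ 2 ^ (1 : ℝ) :=
        Real.rpow_le_rpow_of_exponent_le (by norm_num) (by norm_num)
      rw [Real.rpow_one] at this
      linarith
    _ = _ := one_mul _

/-! ### Linearisation of the rescaled nonlinearity -/

theorem exists_abs_rpow_sub_one_le (p : ℝ) :
    ∃ A : ℝ, 0 ≤ A ∧ ∀ b ∈ Set.Icc (1 / 2 : ℝ) (3 / 2), |b ^ p - 1| ≤ A * |b - 1| := by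
  have hc : ContinuousOn (fun b : ℝ => p * b ^ (p - 1)) (Set.Icc (1 / 2 : ℝ) (3 / 2)) := by
    intro b hb
    have : b ≠ 0 := by linarith [hb.1]
    exact (continuousAt_const.mul
      (Real.continuousAt_rpow_const _ _ (Or.inl this))).continuousWithinAt
  obtain ⟨A, hA⟩ := isCompact_Icc.exists_bound_of_continuousOn hc
  refine ⟨A, (norm_nonneg _).trans (hA 1 (by norm_num)), fun b hb => ?_⟩
  have := (convex_Icc (1 / 2 : ℝ) (3 / 2)).norm_image_sub_le_of_norm_hasDerivWithin_le
    (f := fun b : ℝ => b ^ p) (f' := fun b : ℝ => p * b ^ (p - 1)) (C := A) (x := 1) (y := b)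
    (fun x hx => (Real.hasDerivAt_rpow_const
      (Or.inl (by linarith [hx.1]))).hasDerivWithinAt) hA (by norm_num) hb
  simpa using this

theorem Real.abs_exp_sub_one_le_mul_exp_abs (x : ℝ) :
    |Real.exp x - 1| ≤ |x| * Real.exp |x| := by
  have h1 := Real.add_one_le_exp x
  have h2 := Real.add_one_le_exp (-x)
  have h3 : Real.exp x * Real.exp (-x) = 1 := by rw [← Real.exp_add]; simp
  have h4 := Real.exp_pos x
  have h5 : Real.exp x ≤ Real.exp |x| := Real.exp_le_exp.2 (le_abs_self x)
  have h6 : 1 ≤ Real.exp |x| := Real.one_le_exp (abs_nonneg x)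
  rw [abs_le]
  constructor
  · nlinarith [neg_abs_le x, abs_nonneg x]
  · calc Real.exp x - 1 ≤ x * Real.exp x := by nlinarith
      _ ≤ |x| * Real.exp x := by gcongr; exact le_abs_self x
      _ ≤ |x| * Real.exp |x| := by gcongr

/-- The nonlinearity `s ^ r * exp (s ^ q)` in rescaled form. -/
noncomputable def rescaledNonlinearity (q r ε ξ : ℝ) : ℝ :=
  (1 + ε * ξ) ^ r * Real.exp (((1 + ε * ξ) ^ q - 1) / ε)

theorem rescaledNonlinearity_zero (q r ε : ℝ) : rescaledNonlinearity q r ε 0 = 1 := by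
  simp [rescaledNonlinearity]

/-- The rescaled nonlinearity is close to linear with slope `q`, in the Lipschitz sense. -/
theorem exists_abs_rescaledNonlinearity_sub_le (q r : ℝ) :
    ∃ C : ℝ, 0 ≤ C ∧ ∀ ε δ : ℝ, 0 < ε → ε ≤ 1 / 2 → δ ≤ 1 →
      ∀ x y : ℝ, |x| ≤ δ → |y| ≤ δ →
      |rescaledNonlinearity q r ε x - rescaledNonlinearity q r ε y - q * (x - y)|
        ≤ C * (ε + δ) * |x - y| := by
  obtain ⟨A₁, hA₁, h₁⟩ := exists_abs_rpow_sub_one_le r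
  obtain ⟨A₂, hA₂, h₂⟩ := exists_abs_rpow_sub_one_le q
  obtain ⟨A₃, hA₃, h₃⟩ := exists_abs_rpow_sub_one_le (q - 1)
  set G : ℝ := (1 + A₁) * (A₂ * Real.exp A₂) + A₁ with hG
  set M : ℝ := 2 * |r| + |q| * A₃ with hM
  have hG0 : 0 ≤ G := by positivity
  have hM0 : 0 ≤ M := by positivity
  refine ⟨(1 + G) * M + |q| * G, by positivity, ?_⟩
  intro ε δ hε hε2 hδ x y hx hy
  have hδ0 : 0 ≤ δ := (abs_nonneg x).trans hx
  -- `h` is the logarithmic derivative in `ξ`. The nonlinearity is `1 + O(δ)` and `h` is `q + O(ε)`,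
  -- so the derivative is `q + O(ε + δ)` and the mean value inequality on `[-δ, δ]` concludes.
  set h : ℝ → ℝ := fun ξ => r * ε * (1 + ε * ξ)⁻¹ + q * (1 + ε * ξ) ^ (q - 1) with hh
  have hb : ∀ ξ, |ξ| ≤ δ → 1 + ε * ξ ∈ Set.Icc (1 / 2 : ℝ) (3 / 2) ∧ |ε * ξ| ≤ ε * δ := by
    intro ξ hξ
    have h4 : |ε * ξ| ≤ ε * δ := by rw [abs_mul, abs_of_pos hε]; gcongr
    have h5 : |ε * ξ| ≤ 1 / 2 := h4.trans (by nlinarith)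
    have := abs_le.1 h5
    exact ⟨⟨by linarith, by linarith⟩, h4⟩
  have hderiv : ∀ ξ, |ξ| ≤ δ → HasDerivAt (rescaledNonlinearity q r ε)
      (rescaledNonlinearity q r ε ξ * h ξ) ξ := by
    intro ξ hξ
    have hb0 : 0 < 1 + ε * ξ := by linarith [(hb ξ hξ).1.1]
    have e0 : HasDerivAt (fun ξ => 1 + ε * ξ) ε ξ := by
      simpa using ((hasDerivAt_id ξ).const_mul ε).const_add 1
    have e1 := e0.rpow_const (p := r) (Or.inl hb0.ne')
    have e2 := (((e0.rpow_const (p := q) (Or.inl hb0.ne')).sub_const 1).div_const ε).exp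
    refine (e1.mul e2).congr_deriv ?_
    rw [hh, rescaledNonlinearity, Real.rpow_sub_one hb0.ne' r]
    field_simp
  have hest : ∀ ξ, |ξ| ≤ δ → |rescaledNonlinearity q r ε ξ * h ξ - q|
      ≤ ((1 + G) * M + |q| * G) * (ε + δ) := by
    intro ξ hξ
    obtain ⟨hb1, hb2⟩ := hb ξ hξ
    have hb0 : 0 < 1 + ε * ξ := by linarith [hb1.1]
    have e1 := h₁ _ hb1
    have e2 := h₂ _ hb1
    have e3 := h₃ _ hb1
    rw [add_sub_cancel_left] at e1 e2 e3
    have e4 : |((1 + ε * ξ) ^ q - 1) / ε| ≤ A₂ * δ := by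
      rw [abs_div, abs_of_pos hε, div_le_iff₀ hε]
      calc _ ≤ A₂ * |ε * ξ| := e2
        _ ≤ A₂ * (ε * δ) := by gcongr
        _ = _ := by ring
    have e5 : |Real.exp (((1 + ε * ξ) ^ q - 1) / ε) - 1| ≤ A₂ * Real.exp A₂ * δ := by
      refine (Real.abs_exp_sub_one_le_mul_exp_abs _).trans ?_
      have : A₂ * δ ≤ A₂ := by nlinarith
      calc _ ≤ A₂ * δ * Real.exp A₂ := by gcongr; exact e4.trans this
        _ = _ := by ring
    have e6 : |(1 + ε * ξ) ^ r - 1| ≤ A₁ * δ := by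
      refine e1.trans ?_
      gcongr
      refine hb2.trans ?_
      nlinarith
    have e7 : |(1 + ε * ξ) ^ r| ≤ 1 + A₁ := by
      calc |(1 + ε * ξ) ^ r| = |1 + ((1 + ε * ξ) ^ r - 1)| := by ring_nf
        _ ≤ |1| + |(1 + ε * ξ) ^ r - 1| := abs_add_le _ _
        _ ≤ 1 + A₁ := by rw [abs_one]; nlinarith
    have e8 : |rescaledNonlinearity q r ε ξ - 1| ≤ G * δ := by
      have : rescaledNonlinearity q r ε ξ - 1 = (1 + ε * ξ) ^ r *
          (Real.exp (((1 + ε * ξ) ^ q - 1) / ε) - 1) + ((1 + ε * ξ) ^ r - 1) := by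
        rw [rescaledNonlinearity]; ring
      rw [this]
      calc _ ≤ |(1 + ε * ξ) ^ r| * |Real.exp (((1 + ε * ξ) ^ q - 1) / ε) - 1|
            + |(1 + ε * ξ) ^ r - 1| := by rw [← abs_mul]; exact abs_add_le _ _
        _ ≤ (1 + A₁) * (A₂ * Real.exp A₂ * δ) + A₁ * δ := by gcongr
        _ = _ := by rw [hG]; ring
    have e9 : |rescaledNonlinearity q r ε ξ| ≤ 1 + G := by
      calc _ = |1 + (rescaledNonlinearity q r ε ξ - 1)| := by ring_nf
        _ ≤ |1| + |rescaledNonlinearity q r ε ξ - 1| := abs_add_le _ _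
        _ ≤ 1 + G := by rw [abs_one]; nlinarith
    have e10 : |h ξ - q| ≤ M * ε := by
      have : h ξ - q = r * ε * (1 + ε * ξ)⁻¹ + q * ((1 + ε * ξ) ^ (q - 1) - 1) := by
        rw [hh]; ring
      rw [this]
      have i1 : |(1 + ε * ξ)⁻¹| ≤ 2 := by
        rw [abs_of_pos (inv_pos.2 hb0), inv_le_comm₀ hb0 (by norm_num)]
        linarith [hb1.1]
      calc _ ≤ |r * ε * (1 + ε * ξ)⁻¹| + |q * ((1 + ε * ξ) ^ (q - 1) - 1)| := abs_add_le _ _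
        _ = |r| * ε * |(1 + ε * ξ)⁻¹| + |q| * |(1 + ε * ξ) ^ (q - 1) - 1| := by
          rw [abs_mul, abs_mul, abs_of_pos hε, abs_mul]
        _ ≤ |r| * ε * 2 + |q| * (A₃ * ε) := by
          gcongr
          refine e3.trans ?_
          gcongr
          refine hb2.trans ?_
          nlinarith
        _ = _ := by rw [hM]; ring
    have : rescaledNonlinearity q r ε ξ * h ξ - q = rescaledNonlinearity q r ε ξ * (h ξ - q)
        + q * (rescaledNonlinearity q r ε ξ - 1) := by ring
    rw [this]
    calc _ ≤ |rescaledNonlinearity q r ε ξ| * |h ξ - q|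
          + |q| * |rescaledNonlinearity q r ε ξ - 1| := by
          rw [← abs_mul, ← abs_mul]; exact abs_add_le _ _
      _ ≤ (1 + G) * (M * ε) + |q| * (G * δ) := by gcongr
      _ ≤ _ := by
        have j1 : 0 ≤ (1 + G) * M * δ := by positivity
        have j2 : 0 ≤ |q| * G * ε := by positivity
        nlinarith
  have := (convex_Icc (-δ) δ).norm_image_sub_le_of_norm_hasDerivWithin_le
    (f := fun ξ => rescaledNonlinearity q r ε ξ - q * ξ)
    (f' := fun ξ => rescaledNonlinearity q r ε ξ * h ξ - q)
    (C := ((1 + G) * M + |q| * G) * (ε + δ)) (x := y) (y := x)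
    (fun ξ hξ => by
      have e := (hderiv ξ (abs_le.2 hξ)).sub ((hasDerivAt_id ξ).const_mul q)
      rw [mul_one] at e
      exact e.hasDerivWithinAt) (fun ξ hξ => hest ξ (abs_le.2 hξ)) (abs_le.1 hy) (abs_le.1 hx)
  rw [Real.norm_eq_abs, Real.norm_eq_abs] at this
  convert this using 2
  ring

/-! ### Approximate solution and its residual -/

theorem hasDerivAt_rpow_of_hasDerivAt_div_add {W : ℝ → ℝ} {a s : ℝ}
    (hW : HasDerivAt W (W s / (W s + a)) s) (h0 : 0 < W s) (p : ℝ) :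
    HasDerivAt (fun s => W s ^ p) (p * W s ^ p / (W s + a)) s := by
  refine (hW.rpow_const (p := p) (Or.inl h0.ne')).congr_deriv ?_
  rw [Real.rpow_sub_one h0.ne' p]
  field_simp

theorem hasDerivAt_rpow_div_add_of_hasDerivAt_div_add {W : ℝ → ℝ} {a s : ℝ}
    (hW : HasDerivAt W (W s / (W s + a)) s) (h0 : 0 < W s) (ha : 0 < W s + a) (p : ℝ) :
    HasDerivAt (fun s => p * W s ^ p / (W s + a))
      (p * W s ^ p * (p / (W s + a) ^ 2 - W s / (W s + a) ^ 3)) s := by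
  refine (((hasDerivAt_rpow_of_hasDerivAt_div_add hW h0 p).const_mul p).div
    (hW.add_const a) ha.ne').congr_deriv ?_
  field_simp

/-- The residual left in the rescaled equation by the second-order approximate solution
`y ^ p + b * y ^ (p - 2)`. -/
noncomputable def approxResidual (p a b y : ℝ) : ℝ :=
  p * y * (p / (y + a) ^ 2 - y / (y + a) ^ 3)
    + b * (p - 2) / y * ((p - 2) / (y + a) ^ 2 - y / (y + a) ^ 3)
    + p * (1 - p) / y + (1 - p) * b / y ^ 2

/-- In the expansion in `1/y` the first-order terms cancel identically. The second-order coefficient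
is `a p (3 - 2p) + (1 - p) b`, and the hypothesis on `b` says precisely that it vanishes. -/
theorem exists_abs_approxResidual_le {p a b : ℝ} (hb : (1 - p) * b = -(a * p * (3 - 2 * p))) :
    ∃ C : ℝ, 0 ≤ C ∧ ∀ y : ℝ, 1 + 2 * |a| ≤ y → |approxResidual p a b y| ≤ C / y ^ 3 := by
  refine ⟨|p| * (|a ^ 2 * (3 * p - 6)| + |a ^ 3 * (5 * p - 8)| + |a ^ 4 * (3 - 2 * p)|) * 8
    + |b * (p - 2)| * (|p - 2| * 4 + 8), by positivity, fun y hy => ?_⟩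
  have hy1 : 1 ≤ y := by linarith [abs_nonneg a]
  have hy0 : 0 < y := by linarith
  have hya : y / 2 ≤ y + a := by linarith [neg_abs_le a]
  have hya0 : 0 < y + a := by linarith
  have hsq : 1 / (y + a) ^ 2 ≤ 4 / y ^ 2 := by
    rw [div_le_div_iff₀ (by positivity) (by positivity)]
    have : (y / 2) ^ 2 ≤ (y + a) ^ 2 := by gcongr
    nlinarith
  have hcu : 1 / (y + a) ^ 3 ≤ 8 / y ^ 3 := by
    rw [div_le_div_iff₀ (by positivity) (by positivity)]
    have : (y / 2) ^ 3 ≤ (y + a) ^ 3 := by gcongr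
    nlinarith
  have hsplit : approxResidual p a b y =
      p * ((a ^ 2 * (3 * p - 6)) * y ^ 2 + (a ^ 3 * (5 * p - 8)) * y - a ^ 4 * (3 - 2 * p)) / y ^ 2
        * (1 / (y + a) ^ 3)
      + b * (p - 2) / y * ((p - 2) * (1 / (y + a) ^ 2) - y * (1 / (y + a) ^ 3)) := by
    rw [approxResidual, hb]
    field_simp
    ring
  rw [hsplit]
  have h1 : |p * ((a ^ 2 * (3 * p - 6)) * y ^ 2 + (a ^ 3 * (5 * p - 8)) * y - a ^ 4 * (3 - 2 * p))
      / y ^ 2 * (1 / (y + a) ^ 3)| ≤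
      |p| * (|a ^ 2 * (3 * p - 6)| + |a ^ 3 * (5 * p - 8)| + |a ^ 4 * (3 - 2 * p)|)
        * (8 / y ^ 3) := by
    rw [abs_mul, abs_of_pos (by positivity : 0 < 1 / (y + a) ^ 3), abs_div, abs_mul,
      abs_of_pos (by positivity : 0 < y ^ 2)]
    refine mul_le_mul ?_ hcu (by positivity) (by positivity)
    rw [div_le_iff₀ (by positivity), mul_assoc |p|]
    refine mul_le_mul_of_nonneg_left ?_ (abs_nonneg p)
    have hyy : y ≤ y ^ 2 := by nlinarith
    have h1y : 1 ≤ y ^ 2 := by nlinarith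
    calc _ ≤ |a ^ 2 * (3 * p - 6) * y ^ 2 + a ^ 3 * (5 * p - 8) * y| + |a ^ 4 * (3 - 2 * p)| :=
          abs_sub _ _
      _ ≤ |a ^ 2 * (3 * p - 6) * y ^ 2| + |a ^ 3 * (5 * p - 8) * y| + |a ^ 4 * (3 - 2 * p)| := by
          gcongr; exact abs_add_le _ _
      _ = |a ^ 2 * (3 * p - 6)| * y ^ 2 + |a ^ 3 * (5 * p - 8)| * y
          + |a ^ 4 * (3 - 2 * p)| * 1 := by
          rw [abs_mul _ (y ^ 2), abs_mul _ y, abs_of_pos hy0,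
            abs_of_pos (by positivity : 0 < y ^ 2), mul_one]
      _ ≤ |a ^ 2 * (3 * p - 6)| * y ^ 2 + |a ^ 3 * (5 * p - 8)| * y ^ 2
          + |a ^ 4 * (3 - 2 * p)| * y ^ 2 := by gcongr
      _ = _ := by ring
  have h2 : |b * (p - 2) / y * ((p - 2) * (1 / (y + a) ^ 2) - y * (1 / (y + a) ^ 3))| ≤
      |b * (p - 2)| / y * (|p - 2| * (4 / y ^ 2) + y * (8 / y ^ 3)) := by
    rw [abs_mul, abs_div, abs_of_pos hy0]
    gcongr
    calc _ ≤ |(p - 2) * (1 / (y + a) ^ 2)| + |y * (1 / (y + a) ^ 3)| := abs_sub _ _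
      _ = |p - 2| * (1 / (y + a) ^ 2) + y * (1 / (y + a) ^ 3) := by
        rw [abs_mul, abs_of_pos (by positivity : 0 < 1 / (y + a) ^ 2),
          abs_of_pos (by positivity : 0 < y * (1 / (y + a) ^ 3))]
      _ ≤ _ := by gcongr
  refine (abs_add_le _ _).trans ((add_le_add h1 h2).trans (le_of_eq ?_))
  field_simp

/-! ### Model oscillator and its perturbation -/

/-- The oscillating function `s^(1/4) cos(ν √s + β)`. -/
noncomputable def besselWave (ν β s : ℝ) : ℝ :=
  s ^ (1 / 4 : ℝ) * Real.cos (ν * s ^ (1 / 2 : ℝ) + β)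

/-- The derivative of `besselWave ν β`. -/
noncomputable def besselWaveDeriv (ν β s : ℝ) : ℝ :=
  1 / 4 * s ^ (-(3 / 4) : ℝ) * Real.cos (ν * s ^ (1 / 2 : ℝ) + β)
    - ν / 2 * s ^ (-(1 / 4) : ℝ) * Real.sin (ν * s ^ (1 / 2 : ℝ) + β)

theorem hasDerivAt_phase (ν β : ℝ) {s : ℝ} (hs : 0 < s) :
    HasDerivAt (fun s : ℝ => ν * s ^ (1 / 2 : ℝ) + β) (ν / 2 * s ^ (-(1 / 2) : ℝ)) s := by
  refine (((Real.hasDerivAt_rpow_const (p := 1 / 2) (Or.inl hs.ne')).const_mul ν).add_const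
    β).congr_deriv ?_
  norm_num
  ring

theorem hasDerivAt_besselWave (ν β : ℝ) {s : ℝ} (hs : 0 < s) :
    HasDerivAt (besselWave ν β) (besselWaveDeriv ν β s) s := by
  have h1 : HasDerivAt (fun s : ℝ => s ^ (1 / 4 : ℝ)) (1 / 4 * s ^ (-(3 / 4) : ℝ)) s := by
    refine (Real.hasDerivAt_rpow_const (p := 1 / 4) (Or.inl hs.ne')).congr_deriv ?_
    norm_num
  refine (h1.mul (hasDerivAt_phase ν β hs).cos).congr_deriv ?_
  rw [besselWaveDeriv, show (-(1 / 4) : ℝ) = 1 / 4 + -(1 / 2) by norm_num, Real.rpow_add hs]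
  ring

/-- The amplitude `s^(1/4)` is the WKB one: it cancels the sine terms of order `s^(-5/4)`.
Differentiating the amplitude twice leaves the `3/16 s⁻²` correction to the potential. -/
theorem hasDerivAt_besselWaveDeriv (ν β : ℝ) {s : ℝ} (hs : 0 < s) :
    HasDerivAt (besselWaveDeriv ν β)
      (-(ν ^ 2 / 4 / s + 3 / 16 / s ^ 2) * besselWave ν β s) s := by
  have h1 : HasDerivAt (fun s : ℝ => 1 / 4 * s ^ (-(3 / 4) : ℝ))
      (1 / 4 * (-(3 / 4) * s ^ (-(7 / 4) : ℝ))) s := by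
    refine ((Real.hasDerivAt_rpow_const (p := -(3 / 4)) (Or.inl hs.ne')).const_mul
      (1 / 4)).congr_deriv ?_
    norm_num
  have h2 : HasDerivAt (fun s : ℝ => ν / 2 * s ^ (-(1 / 4) : ℝ))
      (ν / 2 * (-(1 / 4) * s ^ (-(5 / 4) : ℝ))) s := by
    refine ((Real.hasDerivAt_rpow_const (p := -(1 / 4)) (Or.inl hs.ne')).const_mul
      (ν / 2)).congr_deriv ?_
    norm_num
  have hp := hasDerivAt_phase ν β hs
  refine ((h1.mul hp.cos).sub (h2.mul hp.sin)).congr_deriv ?_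
  have hs1 : s⁻¹ = s ^ (-1 : ℝ) := (Real.rpow_neg_one s).symm
  have hs2 : (s ^ 2)⁻¹ = s ^ (-2 : ℝ) := by
    rw [Real.rpow_neg hs.le]; norm_cast
  have e1 : s ^ (-(7 / 4) : ℝ) = (s ^ 2)⁻¹ * s ^ (1 / 4 : ℝ) := by
    rw [hs2, ← Real.rpow_add hs]; norm_num
  have e2 : s ^ (-(3 / 4) : ℝ) * s ^ (-(1 / 2) : ℝ) = s ^ (-(5 / 4) : ℝ) := by
    rw [← Real.rpow_add hs]; norm_num
  have e3 : s ^ (-(1 / 4) : ℝ) * s ^ (-(1 / 2) : ℝ) = s⁻¹ * s ^ (1 / 4 : ℝ) := by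
    rw [hs1, ← Real.rpow_add hs, ← Real.rpow_add hs]; norm_num
  rw [besselWave, e1, div_eq_mul_inv _ s, div_eq_mul_inv _ (s ^ 2)]
  linear_combination (-(ν / 8) * Real.sin (ν * s ^ (1 / 2 : ℝ) + β)) * e2
    - (ν ^ 2 / 4 * Real.cos (ν * s ^ (1 / 2 : ℝ) + β)) * e3

theorem abs_besselWave_le (ν β : ℝ) {s : ℝ} (hs : 0 ≤ s) :
    |besselWave ν β s| ≤ s ^ (1 / 4 : ℝ) := by
  have h := Real.rpow_nonneg hs (1 / 4)
  rw [besselWave, abs_mul, abs_of_nonneg h]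
  exact mul_le_of_le_one_right h (Real.abs_cos_le_one _)

/-- The phase `-π/2` turns the cosine into a sine, giving a second independent solution. The
constant Wronskian is the denominator in variation of parameters. -/
theorem besselWave_wronskian (ν : ℝ) {s : ℝ} (hs : 0 < s) :
    besselWave ν 0 s * besselWaveDeriv ν (-(Real.pi / 2)) s
      - besselWaveDeriv ν 0 s * besselWave ν (-(Real.pi / 2)) s = ν / 2 := by
  have e : s ^ (1 / 4 : ℝ) * s ^ (-(1 / 4) : ℝ) = 1 := by
    rw [← Real.rpow_add hs]; norm_num
  rw [besselWave, besselWave, besselWaveDeriv, besselWaveDeriv, ← sub_eq_add_neg,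
    Real.cos_sub_pi_div_two, Real.sin_sub_pi_div_two, add_zero]
  have h := Real.sin_sq_add_cos_sq (ν * s ^ (1 / 2 : ℝ))
  linear_combination (ν / 2) * (Real.sin (ν * s ^ (1 / 2 : ℝ)) ^ 2
    + Real.cos (ν * s ^ (1 / 2 : ℝ)) ^ 2) * e + ν / 2 * h

theorem abs_clamp_le {d : ℝ} (hd : 0 ≤ d) (x : ℝ) : |max (-d) (min d x)| ≤ d :=
  abs_le.2 ⟨le_max_left _ _, max_le (by linarith) (min_le_left _ _)⟩

theorem abs_clamp_sub_clamp_le (d x y : ℝ) :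
    |max (-d) (min d x) - max (-d) (min d y)| ≤ |x - y| := by
  have h1 := abs_max_sub_max_le_max (-d) (min d x) (-d) (min d y)
  have h2 := abs_min_sub_min_le_max d x d y
  rw [sub_self, abs_zero, max_eq_right (abs_nonneg (min d x - min d y))] at h1
  rw [sub_self, abs_zero, max_eq_right (abs_nonneg (x - y))] at h2
  exact h1.trans h2

theorem clamp_eq_self {d x : ℝ} (hx : |x| ≤ d) : max (-d) (min d x) = x := by
  have := abs_le.1 hx
  rw [min_eq_right this.2, max_eq_right this.1]

/-- Solvability, near infinity, of a perturbation of `η'' + (k / s) η = 0` by a small nonlinear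
term measured in units of the weight `m`. -/
theorem exists_solution_perturbed_oscillator {k l T C M : ℝ} (hk : 0 < k) (hl : l ≤ 1)
    (hT : 1 ≤ T) (hC : 0 ≤ C) {m : ℝ → ℝ} {Γ : ℝ → ℝ → ℝ}
    (hmc : ContinuousOn m (Set.Ici T)) (hm0 : ∀ s, T ≤ s → 0 < m s)
    (hm1 : ∀ s, T ≤ s → m s ≤ M * s ^ l) (hm2 : ∀ s, T ≤ s → s ^ l ≤ M * m s)
    (hΓc : ContinuousOn (Function.uncurry Γ)
      {z : ℝ × ℝ | T ≤ z.1 ∧ |z.2| ≤ z.1 ^ (-(3 / 4) : ℝ)})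
    (hΓ0 : ∀ s, T ≤ s → |Γ s 0| ≤ C * s ^ (-(5 / 2) : ℝ))
    (hΓL : ∀ s, T ≤ s → ∀ x y, |x| ≤ s ^ (-(3 / 4) : ℝ) → |y| ≤ s ^ (-(3 / 4) : ℝ) →
      |Γ s x - Γ s y| ≤ C * s ^ (-(7 / 4) : ℝ) * |x - y|) :
    ∃ (T' D : ℝ) (η η₁ : ℝ → ℝ), T ≤ T' ∧ ∀ s, T' < s →
      HasDerivAt η (η₁ s) s ∧
      HasDerivAt η₁ (-(k / s + 3 / 16 / s ^ 2) * η s + m s * Γ s (η s / m s)) s ∧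
      |η s / m s| ≤ D / s ∧ |η s / m s| ≤ s ^ (-(3 / 4) : ℝ) := by
  set ν : ℝ := 2 * √k with hν
  have hν0 : 0 < ν := by positivity
  have hνk : ν ^ 2 / 4 = k := by rw [hν, mul_pow, Real.sq_sqrt hk.le]; ring
  set e₁ := besselWave ν 0 with he₁
  set e₂ := besselWave ν (-(Real.pi / 2)) with he₂
  set d : ℝ → ℝ := fun s => s ^ (-(3 / 4) : ℝ) with hd
  have hspos : ∀ s, T ≤ s → 0 < s := fun s hs => by linarith
  have hd0 : ∀ s, T ≤ s → 0 ≤ d s := fun s hs => Real.rpow_nonneg (hspos s hs).le _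
  have hM : 0 < M := by
    by_contra h
    have h1 := hm1 T le_rfl
    have h2 := hm0 T le_rfl
    have h3 := Real.rpow_pos_of_pos (hspos T le_rfl) l
    nlinarith
  set Z : ℝ → ℝ × ℝ → ℝ := fun s Y => (e₁ s * Y.1 + e₂ s * Y.2) / m s with hZ
  -- Clamping to `|ξ| ≤ s^(-3/4)`, where `Γ` is controlled, makes the field globally Lipschitz; the
  -- clamp is shown to be inactive on the solution for large `s`.
  set N : ℝ → ℝ × ℝ → ℝ := fun s Y => Γ s (max (-d s) (min (d s) (Z s Y))) with hN
  -- Variation of parameters for `η = e₁ Y₁ + e₂ Y₂`, with `ν / 2` the Wronskian.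
  set H : ℝ → ℝ × ℝ → ℝ × ℝ := fun s Y =>
    (-(e₂ s * (m s * N s Y) / (ν / 2)), e₁ s * (m s * N s Y) / (ν / 2)) with hH
  have he₁b : ∀ s, T ≤ s → |e₁ s| ≤ s ^ (1 / 4 : ℝ) :=
    fun s hs => abs_besselWave_le _ _ (hspos s hs).le
  have he₂b : ∀ s, T ≤ s → |e₂ s| ≤ s ^ (1 / 4 : ℝ) :=
    fun s hs => abs_besselWave_le _ _ (hspos s hs).le
  have hcomb : ∀ s, T ≤ s → ∀ Y : ℝ × ℝ, |e₁ s * Y.1 + e₂ s * Y.2| ≤ 2 * s ^ (1 / 4 : ℝ) * ‖Y‖ := by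
    intro s hs Y
    have h0 : 0 ≤ s ^ (1 / 4 : ℝ) := Real.rpow_nonneg (hspos s hs).le _
    have h1 : |Y.1| ≤ ‖Y‖ := norm_fst_le Y
    have h2 : |Y.2| ≤ ‖Y‖ := norm_snd_le Y
    calc _ ≤ |e₁ s * Y.1| + |e₂ s * Y.2| := abs_add_le _ _
      _ = |e₁ s| * |Y.1| + |e₂ s| * |Y.2| := by rw [abs_mul, abs_mul]
      _ ≤ s ^ (1 / 4 : ℝ) * ‖Y‖ + s ^ (1 / 4 : ℝ) * ‖Y‖ := by
        gcongr
        · exact he₁b s hs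
        · exact he₂b s hs
      _ = _ := by ring
  have hHle : ∀ s, T ≤ s → ∀ t : ℝ,
      ‖(-(e₂ s * (m s * t) / (ν / 2)), e₁ s * (m s * t) / (ν / 2))‖
        ≤ 2 / ν * s ^ (1 / 4 : ℝ) * m s * |t| := by
    intro s hs t
    have h0 := hm0 s hs
    rw [Prod.norm_mk, norm_neg]
    have : ∀ e : ℝ, |e| ≤ s ^ (1 / 4 : ℝ) →
        ‖e * (m s * t) / (ν / 2)‖ ≤ 2 / ν * s ^ (1 / 4 : ℝ) * m s * |t| := by
      intro e he
      rw [Real.norm_eq_abs, abs_div, abs_mul, abs_mul, abs_of_pos h0,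
        abs_of_pos (by positivity : 0 < ν / 2)]
      calc |e| * (m s * |t|) / (ν / 2) ≤ s ^ (1 / 4 : ℝ) * (m s * |t|) / (ν / 2) := by gcongr
        _ = _ := by field_simp
    exact max_le (this _ (he₂b s hs)) (this _ (he₁b s hs))
  have hNb : ∀ s, T ≤ s → ∀ Y, |N s Y| ≤ 2 * C * s ^ (-(5 / 2) : ℝ) := by
    intro s hs Y
    have h1 := hΓ0 s hs
    have hcl := abs_clamp_le (hd0 s hs) (Z s Y)
    have h2 := hΓL s hs (max (-d s) (min (d s) (Z s Y))) 0 hcl (by simpa using hd0 s hs)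
    rw [sub_zero] at h2
    have h3 : |N s Y - Γ s 0| ≤ C * s ^ (-(7 / 4) : ℝ) * s ^ (-(3 / 4) : ℝ) := by
      refine h2.trans ?_
      have := Real.rpow_nonneg (hspos s hs).le (-(7 / 4))
      gcongr
    rw [mul_assoc, ← Real.rpow_add (hspos s hs)] at h3
    norm_num at h3
    have h4 := abs_add_le (N s Y - Γ s 0) (Γ s 0)
    rw [sub_add_cancel] at h4
    norm_num at h1 ⊢
    linarith
  have hNL : ∀ s, T ≤ s → ∀ X Y, |N s X - N s Y| ≤
      C * s ^ (-(7 / 4) : ℝ) * (2 * s ^ (1 / 4 : ℝ) * ‖X - Y‖ / m s) := by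
    intro s hs X Y
    have h0 := hm0 s hs
    have h5 := Real.rpow_nonneg (hspos s hs).le (-(7 / 4))
    refine (hΓL s hs _ _ (abs_clamp_le (hd0 s hs) _) (abs_clamp_le (hd0 s hs) _)).trans ?_
    gcongr
    refine (abs_clamp_sub_clamp_le _ _ _).trans ?_
    have : Z s X - Z s Y = (e₁ s * (X - Y).1 + e₂ s * (X - Y).2) / m s := by
      simp only [hZ, Prod.fst_sub, Prod.snd_sub]; ring
    rw [this, abs_div, abs_of_pos h0]
    gcongr
    exact hcomb s hs (X - Y)
  have hHL : ∀ s, T ≤ s → ∀ X Y, ‖H s X - H s Y‖ ≤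
      (4 / ν * C) * s ^ (-(5 / 4) : ℝ) * ‖X - Y‖ := by
    intro s hs X Y
    have h0 := hm0 s hs
    have hs0 := hspos s hs
    have h14 := Real.rpow_pos_of_pos hs0 (1 / 4)
    have : H s X - H s Y = (-(e₂ s * (m s * (N s X - N s Y)) / (ν / 2)),
        e₁ s * (m s * (N s X - N s Y)) / (ν / 2)) := by
      simp only [hH, Prod.mk_sub_mk]
      ext <;> ring
    rw [this]
    refine (hHle s hs _).trans ?_
    calc _ ≤ 2 / ν * s ^ (1 / 4 : ℝ) * m s *
          (C * s ^ (-(7 / 4) : ℝ) * (2 * s ^ (1 / 4 : ℝ) * ‖X - Y‖ / m s)) := by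
          gcongr; exact hNL s hs X Y
      _ = 4 / ν * C * (s ^ (1 / 4 : ℝ) * s ^ (-(7 / 4) : ℝ) * s ^ (1 / 4 : ℝ)) * ‖X - Y‖ := by
          field_simp; ring
      _ = _ := by
          rw [← Real.rpow_add hs0, ← Real.rpow_add hs0]; norm_num
  have hHb : ∀ s, T ≤ s → ∀ Y, ‖H s Y‖ ≤ (4 / ν * M * C) * s ^ (-(9 / 4 - l)) := by
    intro s hs Y
    have h0 := hm0 s hs
    have hs0 := hspos s hs
    have h14 := Real.rpow_pos_of_pos hs0 (1 / 4)
    refine (hHle s hs _).trans ?_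
    calc _ ≤ 2 / ν * s ^ (1 / 4 : ℝ) * (M * s ^ l) * (2 * C * s ^ (-(5 / 2) : ℝ)) := by
          gcongr
          · exact hm1 s hs
          · exact hNb s hs Y
      _ = 4 / ν * M * C * (s ^ (1 / 4 : ℝ) * s ^ l * s ^ (-(5 / 2) : ℝ)) := by ring
      _ = _ := by
          rw [← Real.rpow_add hs0, ← Real.rpow_add hs0]
          congr 2; ring
  have hrc : ∀ p : ℝ, ContinuousOn (fun s : ℝ => s ^ p) (Set.Ici T) := fun p s hs =>
    (Real.continuousAt_rpow_const _ _ (Or.inl (hspos s hs).ne')).continuousWithinAt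
  have hec : ∀ β, ContinuousOn (besselWave ν β) (Set.Ici T) := fun β s hs =>
    (hasDerivAt_besselWave ν β (hspos s hs)).continuousAt.continuousWithinAt
  have hHc : ∀ Y, ContinuousOn (fun s => H s Y) (Set.Ici T) := by
    intro Y
    have hZc : ContinuousOn (fun s => Z s Y) (Set.Ici T) :=
      (((hec _).mul continuousOn_const).add ((hec _).mul continuousOn_const)).div hmc
        (fun s hs => (hm0 s hs).ne')
    have hclc : ContinuousOn (fun s => max (-d s) (min (d s) (Z s Y))) (Set.Ici T) :=
      ContinuousOn.sup (hrc _).neg (ContinuousOn.inf (hrc _) hZc)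
    have hNc : ContinuousOn (fun s => N s Y) (Set.Ici T) :=
      hΓc.comp (continuousOn_id.prodMk hclc) (fun s hs => ⟨hs, abs_clamp_le (hd0 s hs) _⟩)
    exact ((((hec _).mul (hmc.mul hNc)).div_const _).neg).prodMk
      (((hec _).mul (hmc.mul hNc)).div_const _)
  -- Lipschitz rate: `s^(1/4) · s^(-7/4) · s^(1/4) = s^(-5/4)`. Size: `s^(1/4) · s^l · s^(-5/2)`, so
  -- `μ = 9/4 - l`, and `l ≤ 1` is exactly `μ ≥ 5/4`.
  obtain ⟨Y, hY⟩ := exists_integralCurve_decaying_atTop H hT (by positivity) (by positivity)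
    (by linarith : 5 / 4 ≤ 9 / 4 - l) hHc hHL hHb
  set D : ℝ := 2 * (4 / ν * M * C / (9 / 4 - l - 1)) * M with hD
  have hZb : ∀ s, T < s → |Z s (Y s)| ≤ D / s := by
    intro s hs
    have hs0 := hspos s hs.le
    have h0 := hm0 s hs.le
    have h14 := Real.rpow_pos_of_pos hs0 (1 / 4)
    have hden : 0 < 9 / 4 - l - 1 := by linarith
    simp only [hZ]
    rw [abs_div, abs_of_pos h0, div_le_iff₀ h0]
    calc _ ≤ 2 * s ^ (1 / 4 : ℝ) * ‖Y s‖ := hcomb s hs.le _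
      _ ≤ 2 * s ^ (1 / 4 : ℝ) * (4 / ν * M * C / (9 / 4 - l - 1) * s ^ (1 - (9 / 4 - l))) := by
        gcongr; exact (hY s hs).2
      _ = 2 * (4 / ν * M * C / (9 / 4 - l - 1)) * (s ^ (1 / 4 : ℝ) * s ^ (1 - (9 / 4 - l))) := by
        ring
      _ = 2 * (4 / ν * M * C / (9 / 4 - l - 1)) * (s⁻¹ * s ^ l) := by
        rw [← Real.rpow_neg_one, ← Real.rpow_add hs0, ← Real.rpow_add hs0]
        congr 2; ring
      _ ≤ 2 * (4 / ν * M * C / (9 / 4 - l - 1)) * (s⁻¹ * (M * m s)) := by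
        gcongr; exact hm2 s hs.le
      _ = _ := by rw [hD]; ring
  -- Once `D ≤ s^(1/4)`, the bound `D / s` lies below the clamping level `s^(-3/4)`.
  have hev : ∀ᶠ s : ℝ in Filter.atTop, D ≤ s ^ (1 / 4 : ℝ) :=
    (tendsto_rpow_atTop (by norm_num)).eventually_ge_atTop D
  obtain ⟨T₁, hT₁⟩ := Filter.eventually_atTop.1 hev
  have hZd : ∀ s, max T T₁ < s → |Z s (Y s)| ≤ d s := by
    intro s hs
    have hs1 : T < s := lt_of_le_of_lt (le_max_left _ _) hs
    have hs0 := hspos s hs1.le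
    refine (hZb s hs1).trans ?_
    rw [div_le_iff₀ hs0]
    refine (hT₁ s ((le_max_right _ _).trans hs.le)).trans (le_of_eq ?_)
    rw [hd, ← Real.rpow_add_one hs0.ne']
    norm_num
  refine ⟨max T T₁, D, fun s => e₁ s * (Y s).1 + e₂ s * (Y s).2,
    fun s => besselWaveDeriv ν 0 s * (Y s).1 + besselWaveDeriv ν (-(Real.pi / 2)) s * (Y s).2,
    le_max_left _ _, fun s hs => ?_⟩
  have hs1 : T < s := lt_of_le_of_lt (le_max_left _ _) hs
  have hs0 := hspos s hs1.le
  have h0 := hm0 s hs1.le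
  have hYd := (hY s hs1).1
  have hY1 : HasDerivAt (fun s => (Y s).1) (H s (Y s)).1 s :=
    (ContinuousLinearMap.fst ℝ ℝ ℝ).hasFDerivAt.comp_hasDerivAt s hYd
  have hY2 : HasDerivAt (fun s => (Y s).2) (H s (Y s)).2 s :=
    (ContinuousLinearMap.snd ℝ ℝ ℝ).hasFDerivAt.comp_hasDerivAt s hYd
  have hNe : N s (Y s) = Γ s (Z s (Y s)) := by
    simp only [hN]; rw [clamp_eq_self (hZd s hs)]
  have hw := besselWave_wronskian ν hs0
  refine ⟨?_, ?_, hZb s hs1, hZd s hs⟩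
  · refine (((hasDerivAt_besselWave ν 0 hs0).mul hY1).add
      ((hasDerivAt_besselWave ν (-(Real.pi / 2)) hs0).mul hY2)).congr_deriv ?_
    simp only [hH]
    ring
  · refine (((hasDerivAt_besselWaveDeriv ν 0 hs0).mul hY1).add
      ((hasDerivAt_besselWaveDeriv ν (-(Real.pi / 2)) hs0).mul hY2)).congr_deriv ?_
    change _ = -(k / s + 3 / 16 / s ^ 2) * (e₁ s * (Y s).1 + e₂ s * (Y s).2)
      + m s * Γ s (Z s (Y s))
    rw [← hNe, hνk]
    simp only [hH]
    rw [← he₁, ← he₂] at hw ⊢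
    have : m s * N s (Y s) = (e₁ s * besselWaveDeriv ν (-(Real.pi / 2)) s
      - besselWaveDeriv ν 0 s * e₂ s) * (m s * N s (Y s)) / (ν / 2) := by
      rw [hw]; field_simp
    linear_combination -this

/-! ### Equation for the correction -/

/-- The nonlinearity evaluated at `y ^ p * (1 + ξ / y)`, in terms of its rescaled form. -/
theorem exp_neg_mul_nonlinearity_eq {q r s y ξ : ℝ} (hq : 1 < q) (hy : 0 < y)
    (hys : y + (2 * q + r - 1) / q * Real.log y = s + Real.log (4 * (q - 1) / q ^ 2))
    (hξ : 0 < 1 + y⁻¹ * ξ) :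
    1 / 4 * Real.exp (-s) * ((y ^ (1 / q) * (1 + y⁻¹ * ξ)) ^ r *
      Real.exp ((y ^ (1 / q) * (1 + y⁻¹ * ξ)) ^ q)) =
    1 / q * (1 - 1 / q) * y ^ (1 / q - 1) / y * rescaledNonlinearity q r y⁻¹ ξ := by
  have hq0 : 0 < q := by linarith
  have hyp : 0 < y ^ (1 / q) := Real.rpow_pos_of_pos hy _
  have h1 : (y ^ (1 / q) * (1 + y⁻¹ * ξ)) ^ q = y * (1 + y⁻¹ * ξ) ^ q := by
    rw [Real.mul_rpow hyp.le hξ.le, ← Real.rpow_mul hy.le, one_div, inv_mul_cancel₀ hq0.ne',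
      Real.rpow_one]
  have h2 : (y ^ (1 / q) * (1 + y⁻¹ * ξ)) ^ r = y ^ (r / q) * (1 + y⁻¹ * ξ) ^ r := by
    rw [Real.mul_rpow hyp.le hξ.le, ← Real.rpow_mul hy.le]
    congr 2; ring
  have h3 : Real.exp (-s) =
      4 * (q - 1) / q ^ 2 * Real.exp (-y) * y ^ (-((2 * q + r - 1) / q)) := by
    have hpos : 0 < 4 * (q - 1) / q ^ 2 := by
      have : 0 < q - 1 := by linarith
      positivity
    rw [Real.rpow_def_of_pos hy]
    nth_rw 1 [← Real.exp_log hpos]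
    rw [← Real.exp_add, ← Real.exp_add]
    congr 1
    linarith
  have h4 : y * (1 + y⁻¹ * ξ) ^ q = ((1 + y⁻¹ * ξ) ^ q - 1) / y⁻¹ + y := by
    field_simp; ring
  -- This exponent identity fixes the coefficient of the iterated logarithm: `1/q - 2 = -(2q+r-1)/q
  -- + r/q`.
  have h5 : y ^ (1 / q - 1) / y = y ^ (-((2 * q + r - 1) / q)) * y ^ (r / q) := by
    rw [← Real.rpow_add hy, ← Real.rpow_sub_one hy.ne']
    congr 1; field_simp; ring
  rw [h1, h2, h3, h4, Real.exp_add, mul_div_assoc _ (y ^ (1 / q - 1)) y, h5, rescaledNonlinearity,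
    Real.exp_neg]
  have := Real.exp_pos y
  field_simp

/-- The perturbation term in the equation for the correction to the approximate solution. -/
noncomputable def perturbation (q r p a b y s ξ : ℝ) : ℝ :=
  -approxResidual p a b y
    - p * (1 - p) / y * (rescaledNonlinearity q r y⁻¹ (b / y + ξ) - 1 - q * (b / y + ξ))
    - ((1 - p) / y - (1 - p) / s) * ξ + 3 / 16 / s ^ 2 * ξ

/-- Keeps the rescaled argument `b / y + ξ` in the range where the linearisation estimate holds, and
the base of the real powers away from zero. -/
theorem eventually_abs_div_add_le (b : ℝ) :
    ∀ᶠ s : ℝ in Filter.atTop, 4 ≤ s ∧ s⁻¹ ≤ s ^ (-(3 / 4) : ℝ) ∧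
      (2 * |b| + 1) * s ^ (-(3 / 4) : ℝ) ≤ 1 ∧
      ∀ y ξ, s / 2 ≤ y → |ξ| ≤ s ^ (-(3 / 4) : ℝ) →
        |b / y + ξ| ≤ (2 * |b| + 1) * s ^ (-(3 / 4) : ℝ) ∧ 1 / 2 ≤ 1 + y⁻¹ * (b / y + ξ) := by
  have h1 : Filter.Tendsto (fun s : ℝ => (2 * |b| + 1) * s ^ (-(3 / 4) : ℝ)) Filter.atTop (𝓝 0) := by
    simpa using (tendsto_rpow_neg_atTop (y := 3 / 4) (by norm_num)).const_mul (2 * |b| + 1)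
  filter_upwards [Filter.eventually_ge_atTop 4, h1.eventually_le_const zero_lt_one] with s hs h2
  have hs0 : 0 < s := by linarith
  have h3 : s⁻¹ ≤ s ^ (-(3 / 4) : ℝ) := by
    rw [← Real.rpow_neg_one]
    exact Real.rpow_le_rpow_of_exponent_le (by linarith) (by norm_num)
  refine ⟨hs, h3, h2, fun y ξ hy hξ => ?_⟩
  have hy0 : 0 < y := by linarith
  have hyi : y⁻¹ ≤ 2 * s⁻¹ := by
    rw [inv_le_comm₀ hy0 (by positivity), mul_inv, inv_inv]; linarith
  have h4 : |b / y + ξ| ≤ (2 * |b| + 1) * s ^ (-(3 / 4) : ℝ) := by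
    calc |b / y + ξ| ≤ |b / y| + |ξ| := abs_add_le _ _
      _ = |b| * y⁻¹ + |ξ| := by rw [abs_div, abs_of_pos hy0, div_eq_mul_inv]
      _ ≤ |b| * (2 * s ^ (-(3 / 4) : ℝ)) + s ^ (-(3 / 4) : ℝ) := by
        gcongr; exact hyi.trans (by linarith)
      _ = _ := by ring
  refine ⟨h4, ?_⟩
  have h5 : y⁻¹ ≤ 1 / 2 := by
    rw [inv_le_comm₀ hy0 (by norm_num)]; linarith
  have h6 : |y⁻¹ * (b / y + ξ)| ≤ 1 / 2 := by
    rw [abs_mul, abs_of_pos (inv_pos.2 hy0)]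
    calc y⁻¹ * |b / y + ξ| ≤ 1 / 2 * 1 := by gcongr; exact h4.trans h2
      _ = 1 / 2 := by norm_num
  linarith [(abs_le.1 h6).1]

/-- At zero, the residual is `O(s⁻³)` and the nonlinear remainder `O(s⁻¹ · s^(-3/4) · s⁻¹)`; both
are within `s^(-5/2)`. For the Lipschitz bound, the nonlinear remainder and the replacement of `1/y`
by `1/s` each cost `s^(-7/4)`, and the `3/16 s⁻²` term costs less. -/
theorem exists_abs_perturbation_le (q r : ℝ) {p a b : ℝ}
    (hb : (1 - p) * b = -(a * p * (3 - 2 * p))) :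
    ∃ C : ℝ, 0 ≤ C ∧ ∀ᶠ s : ℝ in Filter.atTop, ∀ y, |y - s| ≤ s ^ (1 / 4 : ℝ) → s / 2 ≤ y →
      |perturbation q r p a b y s 0| ≤ C * s ^ (-(5 / 2) : ℝ) ∧
      ∀ x x', |x| ≤ s ^ (-(3 / 4) : ℝ) → |x'| ≤ s ^ (-(3 / 4) : ℝ) →
        |perturbation q r p a b y s x - perturbation q r p a b y s x'|
          ≤ C * s ^ (-(7 / 4) : ℝ) * |x - x'| := by
  obtain ⟨CK, hCK, hK⟩ := exists_abs_approxResidual_le hb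
  obtain ⟨Cg, hCg, hg⟩ := exists_abs_rescaledNonlinearity_sub_le q r
  set CL : ℝ := 2 * |p * (1 - p)| * (Cg * (2 * |b| + 3)) + 2 * |1 - p| + 1 with hCL
  set C0 : ℝ := 8 * CK + 4 * |b| * |p * (1 - p)| * (Cg * (2 * |b| + 3)) with hC0
  have hCL0 : 0 ≤ CL := by positivity
  have hC00 : 0 ≤ C0 := by positivity
  refine ⟨CL + C0, by positivity, ?_⟩
  filter_upwards [eventually_abs_div_add_le b, Filter.eventually_ge_atTop (2 + 4 * |a|)]
    with s ⟨hs4, hst, ht1, hbx⟩ hsa y hys hy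
  have hs0 : 0 < s := by linarith
  have hy0 : 0 < y := by linarith
  set t : ℝ := s ^ (-(3 / 4) : ℝ) with ht
  have ht0 : 0 < t := Real.rpow_pos_of_pos hs0 _
  have hyi : y⁻¹ ≤ 2 * s⁻¹ := by
    rw [inv_le_comm₀ hy0 (by positivity), mul_inv, inv_inv]; linarith
  have hyi2 : y⁻¹ ≤ 1 / 2 := by
    rw [inv_le_comm₀ hy0 (by norm_num)]; linarith
  have hgL : ∀ x x', |x| ≤ (2 * |b| + 1) * t → |x'| ≤ (2 * |b| + 1) * t →
      |rescaledNonlinearity q r y⁻¹ x - rescaledNonlinearity q r y⁻¹ x' - q * (x - x')|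
        ≤ Cg * (2 * |b| + 3) * t * |x - x'| := by
    intro x x' hx hx'
    refine (hg y⁻¹ _ (inv_pos.2 hy0) hyi2 ht1 x x' hx hx').trans ?_
    have : y⁻¹ + (2 * |b| + 1) * t ≤ (2 * |b| + 3) * t := by linarith
    calc _ ≤ Cg * ((2 * |b| + 3) * t) * |x - x'| := by gcongr
      _ = _ := by ring
  have h74 : s ^ (-(7 / 4) : ℝ) = s⁻¹ * t := by
    rw [ht, ← Real.rpow_neg_one, ← Real.rpow_add hs0]; norm_num
  have h52 : s⁻¹ ^ 2 * t ≤ s ^ (-(5 / 2) : ℝ) := by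
    rw [ht, inv_pow, ← Real.rpow_natCast s 2, ← Real.rpow_neg hs0.le, ← Real.rpow_add hs0]
    exact Real.rpow_le_rpow_of_exponent_le (by linarith) (by norm_num)
  have h3 : s⁻¹ ^ 3 ≤ s ^ (-(5 / 2) : ℝ) := by
    rw [inv_pow, ← Real.rpow_natCast s 3, ← Real.rpow_neg hs0.le]
    exact Real.rpow_le_rpow_of_exponent_le (by linarith) (by norm_num)
  have h14 : s ^ (1 / 4 : ℝ) = s * t := by
    rw [ht, mul_comm, ← Real.rpow_add_one hs0.ne']; norm_num
  constructor
  · have e1 := hK y (by linarith)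
    have e2 : CK / y ^ 3 ≤ 8 * CK * s⁻¹ ^ 3 := by
      rw [div_eq_mul_inv, ← inv_pow]
      calc CK * y⁻¹ ^ 3 ≤ CK * (2 * s⁻¹) ^ 3 := by gcongr
        _ = _ := by ring
    have hby : |b / y| ≤ 2 * |b| * s⁻¹ := by
      rw [abs_div, abs_of_pos hy0, div_eq_mul_inv]
      calc |b| * y⁻¹ ≤ |b| * (2 * s⁻¹) := by gcongr
        _ = _ := by ring
    have e3 := hgL (b / y) 0 (by
      have := (hbx y 0 hy (by rw [abs_zero]; exact ht0.le)).1
      rwa [add_zero] at this) (by rw [abs_zero]; positivity)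
    rw [rescaledNonlinearity_zero, sub_zero] at e3
    have e4 : perturbation q r p a b y s 0 = -approxResidual p a b y
        - p * (1 - p) / y * (rescaledNonlinearity q r y⁻¹ (b / y) - 1 - q * (b / y)) := by
      rw [perturbation, add_zero]; ring
    rw [e4]
    calc _ ≤ |-approxResidual p a b y| + |p * (1 - p) / y *
          (rescaledNonlinearity q r y⁻¹ (b / y) - 1 - q * (b / y))| := abs_sub _ _
      _ = |approxResidual p a b y| + |p * (1 - p)| * y⁻¹ *
          |rescaledNonlinearity q r y⁻¹ (b / y) - 1 - q * (b / y)| := by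
        rw [abs_neg, abs_mul, abs_div, abs_of_pos hy0, div_eq_mul_inv]
      _ ≤ 8 * CK * s⁻¹ ^ 3 + |p * (1 - p)| * (2 * s⁻¹) *
          (Cg * (2 * |b| + 3) * t * (2 * |b| * s⁻¹)) := by
        gcongr
        · exact e1.trans e2
        · exact e3.trans (by gcongr)
      _ = 8 * CK * s⁻¹ ^ 3 + 4 * |b| * |p * (1 - p)| * (Cg * (2 * |b| + 3)) * (s⁻¹ ^ 2 * t) := by
        ring
      _ ≤ 8 * CK * s ^ (-(5 / 2) : ℝ)
          + 4 * |b| * |p * (1 - p)| * (Cg * (2 * |b| + 3)) * s ^ (-(5 / 2) : ℝ) := by gcongr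
      _ = C0 * s ^ (-(5 / 2) : ℝ) := by rw [hC0]; ring
      _ ≤ _ := by
        have := Real.rpow_pos_of_pos hs0 (-(5 / 2))
        gcongr
        linarith
  · intro x x' hx hx'
    have e1 := hgL (b / y + x) (b / y + x') (hbx y x hy hx).1 (hbx y x' hy hx').1
    rw [add_sub_add_left_eq_sub] at e1
    have e2 : |(1 - p) / y - (1 - p) / s| ≤ 2 * |1 - p| * (s⁻¹ * t) := by
      have : (1 - p) / y - (1 - p) / s = -((1 - p) * (y - s) * y⁻¹ * s⁻¹) := by
        field_simp; ring
      rw [this, abs_neg, abs_mul, abs_mul, abs_mul, abs_of_pos (inv_pos.2 hy0),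
        abs_of_pos (inv_pos.2 hs0)]
      calc _ ≤ |1 - p| * (s * t) * (2 * s⁻¹) * s⁻¹ := by
            gcongr; rwa [← h14]
        _ = _ := by field_simp
    have e3 : |3 / 16 / s ^ 2| ≤ s⁻¹ * t := by
      rw [abs_of_pos (by positivity)]
      calc 3 / 16 / s ^ 2 = 3 / 16 * (s⁻¹ * s⁻¹) := by field_simp
        _ ≤ 1 * (s⁻¹ * t) := by gcongr; norm_num
        _ = _ := one_mul _
    have e4 : perturbation q r p a b y s x - perturbation q r p a b y s x' =
        -(p * (1 - p) * y⁻¹ * (rescaledNonlinearity q r y⁻¹ (b / y + x)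
          - rescaledNonlinearity q r y⁻¹ (b / y + x') - q * (x - x')))
        - ((1 - p) / y - (1 - p) / s) * (x - x') + 3 / 16 / s ^ 2 * (x - x') := by
      rw [perturbation, perturbation]; ring
    rw [e4]
    calc _ ≤ |p * (1 - p)| * y⁻¹ * |rescaledNonlinearity q r y⁻¹ (b / y + x)
          - rescaledNonlinearity q r y⁻¹ (b / y + x') - q * (x - x')|
          + |(1 - p) / y - (1 - p) / s| * |x - x'| + |3 / 16 / s ^ 2| * |x - x'| := by
          refine (abs_add_le _ _).trans ?_
          rw [abs_mul (3 / 16 / s ^ 2)]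
          gcongr
          refine (abs_sub _ _).trans ?_
          rw [abs_neg, abs_mul, abs_mul _ (y⁻¹), abs_of_pos (inv_pos.2 hy0),
            abs_mul ((1 - p) / y - (1 - p) / s)]
      _ ≤ |p * (1 - p)| * (2 * s⁻¹) * (Cg * (2 * |b| + 3) * t * |x - x'|)
          + 2 * |1 - p| * (s⁻¹ * t) * |x - x'| + s⁻¹ * t * |x - x'| := by gcongr
      _ = CL * (s⁻¹ * t) * |x - x'| := by rw [hCL]; ring
      _ ≤ _ := by
        rw [h74]
        gcongr
        linarith

theorem continuousAt_perturbation {q r p a b : ℝ} {W : ℝ → ℝ} {z : ℝ × ℝ}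
    (hW : ContinuousAt W z.1) (hz : 0 < z.1) (hW0 : 0 < W z.1) (hWa : 0 < W z.1 + a)
    (hpos : 0 < 1 + (W z.1)⁻¹ * (b / W z.1 + z.2)) :
    ContinuousAt (Function.uncurry fun s ξ => perturbation q r p a b (W s) s ξ) z := by
  have h1 : ContinuousAt (fun z : ℝ × ℝ => W z.1) z :=
    ContinuousAt.comp (g := W) hW continuousAt_fst
  have h2 : ContinuousAt (fun z : ℝ × ℝ => z.2) z := continuousAt_snd
  have h3 : ContinuousAt (fun z : ℝ × ℝ => z.1) z := continuousAt_fst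
  have h4 : ContinuousAt (fun z : ℝ × ℝ => b / W z.1 + z.2) z :=
    (continuousAt_const.div h1 hW0.ne').add h2
  have h5 : ContinuousAt (fun z : ℝ × ℝ => 1 + (W z.1)⁻¹ * (b / W z.1 + z.2)) z :=
    continuousAt_const.add ((h1.inv₀ hW0.ne').mul h4)
  have h6 : ContinuousAt (fun z : ℝ × ℝ =>
      rescaledNonlinearity q r (W z.1)⁻¹ (b / W z.1 + z.2)) z := by
    refine (h5.rpow_const (Or.inl hpos.ne')).mul ?_
    exact (((h5.rpow_const (Or.inl hpos.ne')).sub continuousAt_const).div (h1.inv₀ hW0.ne')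
      (inv_ne_zero hW0.ne')).rexp
  have h7 : ContinuousAt (fun z : ℝ × ℝ => W z.1 + a) z := h1.add continuousAt_const
  have h8 : ContinuousAt (fun z : ℝ × ℝ => approxResidual p a b (W z.1)) z := by
    have hn : W z.1 ≠ 0 := hW0.ne'
    have hna : W z.1 + a ≠ 0 := hWa.ne'
    have c2 : ∀ e : ℝ, ContinuousAt (fun z : ℝ × ℝ => e / (W z.1 + a) ^ 2
        - W z.1 / (W z.1 + a) ^ 3) z := fun e =>
      (continuousAt_const.div (h7.pow 2) (pow_ne_zero 2 hna)).sub
        (h1.div (h7.pow 3) (pow_ne_zero 3 hna))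
    exact (((((continuousAt_const.mul h1).mul (c2 p)).add
      ((continuousAt_const.div h1 hn).mul (c2 (p - 2)))).add (continuousAt_const.div h1 hn)).add
      (continuousAt_const.div (h1.pow 2) (pow_ne_zero 2 hn)))
  exact ((h8.neg.sub ((continuousAt_const.div h1 hW0.ne').mul
    ((h6.sub continuousAt_const).sub (continuousAt_const.mul h4)))).sub
    (((continuousAt_const.div h1 hW0.ne').sub (continuousAt_const.div h3 hz.ne')).mul h2)).add
    ((continuousAt_const.div (h3.pow 2) (pow_ne_zero 2 hz.ne')).mul h2)

/-! ### Existence and smoothness for the radial equation -/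

/-- A solution of `v'' = -(1/4) e^{-s} v^r e^{v^q}` near infinity, close to `W ^ (1 / q)`. -/
theorem exists_solution_near_inverse_profile {q : ℝ} (r : ℝ) (hq : 1 < q) :
    ∃ (T C : ℝ) (W v v₁ : ℝ → ℝ), 1 ≤ T ∧ Filter.Tendsto W Filter.atTop Filter.atTop ∧
      ∀ s, T < s →
        W s + (2 * q + r - 1) / q * Real.log (W s) = s + Real.log (4 * (q - 1) / q ^ 2) ∧
        s / 2 ≤ W s ∧ W s ≤ 2 * s ∧ W s ^ (1 / q) / 2 ≤ v s ∧
        HasDerivAt v (v₁ s) s ∧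
        HasDerivAt v₁ (-(1 / 4 * Real.exp (-s) * (v s ^ r * Real.exp (v s ^ q)))) s ∧
        |v s - W s ^ (1 / q)| ≤ C * (W s ^ (1 / q - 1) / s) := by
  have hq0 : 0 < q := by linarith
  set a : ℝ := (2 * q + r - 1) / q with ha
  set c : ℝ := Real.log (4 * (q - 1) / q ^ 2) with hc
  set p : ℝ := 1 / q with hp
  have hp1 : p < 1 := by rw [hp, div_lt_one hq0]; exact hq
  have hpq : p * q = 1 := by rw [hp]; field_simp
  set b : ℝ := -(a * p * (3 - 2 * p)) / (1 - p) with hbdef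
  have hb : (1 - p) * b = -(a * p * (3 - 2 * p)) := by
    have : 1 - p ≠ 0 := by linarith
    rw [hbdef]; field_simp
  obtain ⟨W, hWtop, hW⟩ := exists_inverse_add_mul_log a c
  have hWcmp := eventually_abs_sub_le_of_add_mul_log hWtop (hW.mono fun s h => h.1)
  obtain ⟨C, hC0, hC⟩ := exists_abs_perturbation_le q r hb
  obtain ⟨T₀, hT₀⟩ := Filter.eventually_atTop.1 ((((hW.and hWcmp).and hC).and
    (eventually_abs_div_add_le b)).and (hWtop.eventually_ge_atTop (1 + 2 * |a|)))
  set T : ℝ := max T₀ 1 with hT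
  have hT1 : 1 ≤ T := le_max_right _ _
  have hspos : ∀ s, T ≤ s → 0 < s := fun s hs => by linarith
  have hall := fun s (hs : T ≤ s) => hT₀ s ((le_max_left _ _).trans hs)
  have hW0 : ∀ s, T ≤ s → 0 < W s := fun s hs => by
    linarith [(hall s hs).2, abs_nonneg a]
  have hWa : ∀ s, T ≤ s → 0 < W s + a := fun s hs => by
    linarith [(hall s hs).2, neg_abs_le a, abs_nonneg a]
  have hWd : ∀ s, T ≤ s → HasDerivAt W (W s / (W s + a)) s := fun s hs => (hall s hs).1.1.1.1.2
  have hWl : ∀ s, T ≤ s → s / 2 ≤ W s := fun s hs => (hall s hs).1.1.1.2.2.1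
  have hWu : ∀ s, T ≤ s → W s ≤ 2 * s := fun s hs => (hall s hs).1.1.1.2.2.2
  set m : ℝ → ℝ := fun s => W s ^ (p - 1) with hm
  have hm0 : ∀ s, T ≤ s → 0 < m s := fun s hs => Real.rpow_pos_of_pos (hW0 s hs) _
  have hlneg : p - 1 ≤ 0 := by linarith
  -- The weight `W^(p-1)` is the size of `v - W^p` per unit of `b / W + ξ`. It is comparable with
  -- `s^(p-1)` up to `2^(1-p)`, since `s/2 ≤ W ≤ 2s`.
  obtain ⟨T', D, η, η₁, hT', hη⟩ := exists_solution_perturbed_oscillator (k := 1 - p) (l := p - 1)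
    (T := T) (C := C) (M := 2 ^ (1 - p)) (m := m)
    (Γ := fun s ξ => perturbation q r p a b (W s) s ξ) (by linarith) (by linarith) hT1 hC0
    (fun s hs => ((hWd s hs).continuousAt.rpow_const
      (Or.inl (hW0 s hs).ne')).continuousWithinAt) hm0
    (fun s hs => by
      have hs0 := hspos s hs
      calc m s ≤ (s / 2) ^ (p - 1) :=
            Real.rpow_le_rpow_of_nonpos (by linarith) (hWl s hs) hlneg
        _ = 2 ^ (1 - p) * s ^ (p - 1) := by
          rw [Real.div_rpow hs0.le (by norm_num), show 1 - p = -(p - 1) by ring,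
            Real.rpow_neg (by norm_num)]
          ring)
    (fun s hs => by
      have hs0 := hspos s hs
      have h1 : (2 * s) ^ (p - 1) ≤ m s :=
        Real.rpow_le_rpow_of_nonpos (hW0 s hs) (hWu s hs) hlneg
      rw [Real.mul_rpow (by norm_num) hs0.le] at h1
      calc s ^ (p - 1) = 2 ^ (1 - p) * (2 ^ (p - 1) * s ^ (p - 1)) := by
            rw [← mul_assoc, ← Real.rpow_add (by norm_num)]; simp
        _ ≤ _ := by gcongr)
    (fun z hz => (continuousAt_perturbation (hWd z.1 hz.1).continuousAt (hspos _ hz.1)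
      (hW0 _ hz.1) (hWa _ hz.1) (by
        linarith [((hall z.1 hz.1).1.2.2.2.2 (W z.1) z.2 (hWl _ hz.1) hz.2).2])).continuousWithinAt)
    (fun s hs => ((hall s hs).1.1.2 (W s) (hall s hs).1.1.1.2.1 (hWl s hs)).1)
    (fun s hs => ((hall s hs).1.1.2 (W s) (hall s hs).1.1.1.2.1 (hWl s hs)).2)
  refine ⟨T', 2 * |b| + D, W, fun s => W s ^ p + b * W s ^ (p - 2) + η s,
    fun s => p * W s ^ p / (W s + a) + b * ((p - 2) * W s ^ (p - 2) / (W s + a)) + η₁ s,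
    hT1.trans hT', hWtop, fun s hs => ?_⟩
  have hsT : T ≤ s := hT'.trans hs.le
  have hs0 := hspos s hsT
  have hy0 := hW0 s hsT
  have hya := hWa s hsT
  have hms := hm0 s hsT
  obtain ⟨hη1, hη2, hηD, hηd⟩ := hη s hs
  have hpw1 : W s ^ p = W s * m s := by
    rw [hm, mul_comm, ← Real.rpow_add_one hy0.ne']; congr 1; ring
  have hpw2 : W s ^ (p - 2) = m s / W s := by
    rw [hm, ← Real.rpow_sub_one hy0.ne']; congr 1; ring
  set ξ : ℝ := η s / m s with hξ
  have hηξ : η s = m s * ξ := by rw [hξ]; field_simp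
  have hv : W s ^ p + b * W s ^ (p - 2) + η s =
      W s ^ p * (1 + (W s)⁻¹ * (b / W s + ξ)) := by
    rw [hpw1, hpw2, hηξ]; field_simp; ring
  have hhalf := ((hall s hsT).1.2.2.2.2 (W s) ξ (hWl s hsT) hηd).2
  refine ⟨(hall s hsT).1.1.1.1.1, hWl s hsT, hWu s hsT, ?_, ?_, ?_, ?_⟩
  · change _ ≤ W s ^ p + b * W s ^ (p - 2) + η s
    rw [hv]
    have := Real.rpow_pos_of_pos hy0 p
    nlinarith
  · exact ((hasDerivAt_rpow_of_hasDerivAt_div_add (hWd s hsT) hy0 p).add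
      ((hasDerivAt_rpow_of_hasDerivAt_div_add (hWd s hsT) hy0 (p - 2)).const_mul b)).add hη1
  · refine (((hasDerivAt_rpow_div_add_of_hasDerivAt_div_add (hWd s hsT) hy0 hya p).add
      ((hasDerivAt_rpow_div_add_of_hasDerivAt_div_add (hWd s hsT) hy0 hya (p - 2)).const_mul
        b)).add hη2).congr_deriv ?_
    beta_reduce
    rw [hv, exp_neg_mul_nonlinearity_eq hq hy0 (hall s hsT).1.1.1.1.1 (by linarith), ← hp,
      hpw1, hpw2, hηξ, perturbation, approxResidual]
    change _ = -(p * (1 - p) * m s / W s * rescaledNonlinearity q r (W s)⁻¹ (b / W s + ξ))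
    set g := rescaledNonlinearity q r (W s)⁻¹ (b / W s + ξ)
    -- Since `p q = 1`, the linear coefficient `p(1-p)q` is `1 - p`, the constant `k` of the
    -- oscillator.
    have : m s * (p * (1 - p) / W s * (q * (b / W s + ξ))) =
        m s * ((1 - p) / W s * (b / W s + ξ)) := by
      linear_combination (m s * ((1 - p) / W s * (b / W s + ξ))) * hpq
    linear_combination this
  · change |W s ^ p + b * W s ^ (p - 2) + η s - W s ^ p| ≤ _
    have e1 : W s ^ p + b * W s ^ (p - 2) + η s - W s ^ p = m s * (b / W s + ξ) := by
      rw [hpw2, hηξ]; ring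
    have hyi : (W s)⁻¹ ≤ 2 * s⁻¹ := by
      rw [inv_le_comm₀ hy0 (by positivity), mul_inv, inv_inv]; linarith [hWl s hsT]
    rw [e1, abs_mul, abs_of_pos hms]
    calc m s * |b / W s + ξ| ≤ m s * (|b| * (2 * s⁻¹) + D / s) := by
          gcongr
          refine (abs_add_le _ _).trans ?_
          gcongr
          rw [abs_div, abs_of_pos hy0, div_eq_mul_inv]
          gcongr
      _ = _ := by simp only [hm]; field_simp

/-- Smoothness of positive solutions of `v'' = -(1/4) e^{-s} v^r e^{v^q}`. -/
theorem contDiffOn_of_hasDerivAt_nonlinearity {q r T : ℝ} {v v₁ : ℝ → ℝ}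
    (hv : ∀ s, T < s → HasDerivAt v (v₁ s) s)
    (hv₁ : ∀ s, T < s →
      HasDerivAt v₁ (-(1 / 4 * Real.exp (-s) * (v s ^ r * Real.exp (v s ^ q)))) s)
    (hpos : ∀ s, T < s → 0 < v s) : ContDiffOn ℝ ∞ v (Set.Ioi T) := by
  rw [contDiffOn_infty]
  -- Bootstrap on `v` and its derivative together; positivity of `v` keeps the real powers smooth.
  have key : ∀ n : ℕ, ContDiffOn ℝ n v (Set.Ioi T) ∧ ContDiffOn ℝ n v₁ (Set.Ioi T) := by
    intro n
    induction n with
    | zero =>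
      simp only [Nat.cast_zero, contDiffOn_zero]
      exact ⟨fun s hs => (hv s hs).continuousAt.continuousWithinAt,
        fun s hs => (hv₁ s hs).continuousAt.continuousWithinAt⟩
    | succ n ih =>
      push_cast
      rw [contDiffOn_succ_iff_deriv_of_isOpen isOpen_Ioi,
        contDiffOn_succ_iff_deriv_of_isOpen isOpen_Ioi]
      refine ⟨⟨fun s hs => (hv s hs).differentiableAt.differentiableWithinAt, by simp, ?_⟩,
        ⟨fun s hs => (hv₁ s hs).differentiableAt.differentiableWithinAt, by simp, ?_⟩⟩
      · exact ih.2.congr fun s hs => (hv s hs).deriv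
      · have h1 : ContDiffOn ℝ n (fun s => v s ^ r) (Set.Ioi T) :=
          ih.1.rpow_const_of_ne fun s hs => (hpos s hs).ne'
        have h2 : ContDiffOn ℝ n (fun s => v s ^ q) (Set.Ioi T) :=
          ih.1.rpow_const_of_ne fun s hs => (hpos s hs).ne'
        have h3 : ContDiffOn ℝ n (fun s : ℝ => 1 / 4 * Real.exp (-s)) (Set.Ioi T) := by fun_prop
        exact ((h3.mul (h1.mul h2.exp)).neg).congr fun s hs => (hv₁ s hs).deriv
  exact fun n => (key n).1

/-! ### Return to the plane and the explicit profile -/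

/-- The Laplacian of a radial function of the plane, in terms of `‖x‖ ^ 2`. -/
theorem laplacian_comp_norm_sq {f φ : ℝ → ℝ} {φ' : ℝ} {x : Plane}
    (hf : ∀ᶠ ρ in 𝓝 (‖x‖ ^ 2), HasDerivAt f (φ ρ) ρ) (hφ : HasDerivAt φ φ' (‖x‖ ^ 2)) :
    Laplacian.laplacian (fun y : Plane => f (‖y‖ ^ 2)) x =
      4 * ‖x‖ ^ 2 * φ' + 4 * φ (‖x‖ ^ 2) := by
  obtain ⟨I, hI⟩ : ∃ I : Plane →L[ℝ] Plane →L[ℝ] ℝ, ∀ y, I y = innerSL ℝ y :=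
    ⟨innerSL ℝ, fun _ => rfl⟩
  have hn : ∀ y : Plane, HasFDerivAt (fun y : Plane => ‖y‖ ^ 2) ((2 : ℝ) • I y) y := by
    intro y
    refine (hasStrictFDerivAt_norm_sq y).hasFDerivAt.congr_fderiv ?_
    rw [hI, ofNat_smul_eq_nsmul ℝ 2]
  have hcont : ContinuousAt (fun y : Plane => ‖y‖ ^ 2) x := (hn x).continuousAt
  have h1 : ∀ᶠ y in 𝓝 x, fderiv ℝ (fun y : Plane => f (‖y‖ ^ 2)) y
      = (2 * φ (‖y‖ ^ 2)) • I y := by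
    filter_upwards [hcont.eventually hf] with y hy
    have := (hy.comp_hasFDerivAt y (hn y)).fderiv
    rw [Function.comp_def] at this
    rw [this, smul_smul, mul_comm]
  have h2 : HasFDerivAt (fun y : Plane => (2 * φ (‖y‖ ^ 2)) • I y)
      ((2 * φ (‖x‖ ^ 2)) • I + ((2 : ℝ) • φ' • ((2 : ℝ) • I x)).smulRight (I x)) x :=
    ((hφ.comp_hasFDerivAt x (hn x)).const_mul 2).smul I.hasFDerivAt
  have h3 : fderiv ℝ (fderiv ℝ (fun y : Plane => f (‖y‖ ^ 2))) x = _ :=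
    (h2.congr_of_eventuallyEq h1).fderiv
  -- The Hessian is `2φ · Id + 4φ' x ⊗ x`; its trace in dimension two is the claim.
  rw [InnerProductSpace.laplacian_eq_iteratedFDeriv_orthonormalBasis _
    (EuclideanSpace.basisFun (Fin 2) ℝ)]
  have h4 : ‖x‖ ^ 2 = x 0 ^ 2 + x 1 ^ 2 := by
    rw [EuclideanSpace.norm_sq_eq]; simp
  simp only [iteratedFDeriv_two_apply, h3, Fin.sum_univ_two]
  simp [hI, EuclideanSpace.inner_single_right]
  rw [h4]
  ring

theorem abs_log_sub_log_le {x y s : ℝ} (hs : 0 < s) (hx : s ≤ x) (hy : s ≤ y) :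
    |Real.log x - Real.log y| ≤ s⁻¹ * |x - y| := by
  have key : ∀ x y, s ≤ x → s ≤ y → Real.log x - Real.log y ≤ s⁻¹ * |x - y| := by
    intro x y hx hy
    have hx0 : 0 < x := hs.trans_le hx
    have hy0 : 0 < y := hs.trans_le hy
    have h1 := Real.log_le_sub_one_of_pos (div_pos hx0 hy0)
    rw [Real.log_div hx0.ne' hy0.ne'] at h1
    calc _ ≤ x / y - 1 := h1
      _ = y⁻¹ * (x - y) := by field_simp
      _ ≤ y⁻¹ * |x - y| := by gcongr; exact le_abs_self _
      _ ≤ _ := by gcongr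
  rw [abs_le]
  have := key y x hy hx
  rw [abs_sub_comm] at this
  exact ⟨by linarith, key x y hx hy⟩

theorem abs_rpow_sub_rpow_le {p x y s : ℝ} (hp0 : 0 ≤ p) (hp1 : p ≤ 1) (hs : 0 < s) (hx : s ≤ x)
    (hy : s ≤ y) : |x ^ p - y ^ p| ≤ p * s ^ (p - 1) * |x - y| := by
  refine (convex_Ici s).norm_image_sub_le_of_norm_hasDerivWithin_le (f := fun x : ℝ => x ^ p)
    (f' := fun x => p * x ^ (p - 1)) (fun z hz => ?_) (fun z hz => ?_) hy hx
  · exact (Real.hasDerivAt_rpow_const (Or.inl (hs.trans_le hz).ne')).hasDerivWithinAt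
  · have hz0 : 0 < z := hs.trans_le hz
    rw [Real.norm_eq_abs, abs_of_nonneg (by positivity)]
    exact mul_le_mul_of_nonneg_left (Real.rpow_le_rpow_of_nonpos hs hz (by linarith)) hp0

/-- Passage from the implicitly defined profile `W ^ (1 / q)` to the explicit one. -/
theorem exists_eventually_abs_sub_profile_le {q a c C : ℝ} {W v : ℝ → ℝ} (hq : 1 < q)
    (h : ∀ᶠ s in Filter.atTop, W s + a * Real.log (W s) = s + c ∧ s / 2 ≤ W s ∧ W s ≤ 2 * s ∧
      |v s - W s ^ (1 / q)| ≤ C * (W s ^ (1 / q - 1) / s)) :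
    ∃ D, ∀ᶠ s in Filter.atTop, |v s - (s - a * Real.log s + c) ^ (1 / q)| ≤
      D * (Real.log (s / 2) / (s / 2) ^ (2 - 1 / q)) := by
  set p : ℝ := 1 / q with hp
  have hp0 : 0 < p := by positivity
  have hp1 : p < 1 := by rw [hp, div_lt_one (by linarith)]; exact hq
  have h1 : (fun s : ℝ => a * Real.log s - c) =o[Filter.atTop] fun s : ℝ => s := by
    refine Asymptotics.IsLittleO.sub (Real.isLittleO_log_id_atTop.const_mul_left a) ?_
    exact Asymptotics.isLittleO_const_left.2 (Or.inr tendsto_norm_atTop_atTop)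
  set K : ℝ := |c| + 2 * |a| with hK
  set D : ℝ := |C| + p * (|a| * (2 * K)) with hD
  refine ⟨D, ?_⟩
  filter_upwards [h, h1.bound (show (0 : ℝ) < 1 / 2 by norm_num), Filter.eventually_ge_atTop 4]
    with s ⟨hW, hl, hu, hvW⟩ h2 hs
  have hs0 : 0 < s := by linarith
  have hs2 : 0 < s / 2 := by linarith
  have hW0 : 0 < W s := by linarith
  set P : ℝ := s - a * Real.log s + c with hP
  have hPl : s / 2 ≤ P := by
    rw [Real.norm_eq_abs, Real.norm_eq_abs, abs_of_pos hs0] at h2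
    linarith [(abs_le.1 h2).2]
  have hlog1 : 1 ≤ Real.log s := by
    rw [Real.le_log_iff_exp_le hs0]
    linarith [Real.exp_one_lt_d9]
  have hlogW : |Real.log (W s)| ≤ 2 * Real.log s := by
    rw [abs_of_nonneg (Real.log_nonneg (by linarith))]
    calc Real.log (W s) ≤ Real.log (s ^ 2) := Real.log_le_log hW0 (by nlinarith)
      _ = 2 * Real.log s := by rw [Real.log_pow]; norm_num
  have hWs : |W s - s| ≤ K * Real.log s := by
    have : W s - s = c - a * Real.log (W s) := by linarith
    rw [this]
    calc _ ≤ |c| + |a * Real.log (W s)| := abs_sub _ _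
      _ = |c| * 1 + |a| * |Real.log (W s)| := by rw [abs_mul, mul_one]
      _ ≤ |c| * Real.log s + |a| * (2 * Real.log s) := by gcongr
      _ = _ := by rw [hK]; ring
  -- `W - P = -a (log W - log s)`, and `|W - s| = O(log s)` makes this `O(log s / s)`.
  have hWP : |W s - P| ≤ |a| * (2 * K) * (Real.log s * s⁻¹) := by
    have : W s - P = -(a * (Real.log (W s) - Real.log s)) := by rw [hP]; linarith
    rw [this, abs_neg, abs_mul]
    calc _ ≤ |a| * ((s / 2)⁻¹ * (K * Real.log s)) := by
          gcongr
          refine (abs_log_sub_log_le hs2 hl (by linarith)).trans ?_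
          gcongr
      _ = _ := by field_simp
  have hpow : W s ^ (p - 1) ≤ (s / 2) ^ (p - 1) :=
    Real.rpow_le_rpow_of_nonpos hs2 hl (by linarith)
  have hsp : 0 < (s / 2) ^ (p - 1) := Real.rpow_pos_of_pos hs2 _
  have e1 : |v s - W s ^ p| ≤ |C| * ((s / 2) ^ (p - 1) * (Real.log s * s⁻¹)) := by
    have hWp := Real.rpow_pos_of_pos hW0 (p - 1)
    refine hvW.trans ?_
    rw [div_eq_mul_inv]
    calc _ ≤ |C| * (W s ^ (p - 1) * s⁻¹) := by gcongr; exact le_abs_self C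
      _ ≤ |C| * ((s / 2) ^ (p - 1) * (Real.log s * s⁻¹)) := by
        gcongr
        exact le_mul_of_one_le_left (by positivity) hlog1
  have e2 : |W s ^ p - P ^ p| ≤
      p * (|a| * (2 * K)) * ((s / 2) ^ (p - 1) * (Real.log s * s⁻¹)) := by
    refine (abs_rpow_sub_rpow_le hp0.le hp1.le hs2 hl hPl).trans ?_
    calc _ ≤ p * (s / 2) ^ (p - 1) * (|a| * (2 * K) * (Real.log s * s⁻¹)) := by gcongr
      _ = _ := by ring
  have hD0 : 0 ≤ D := by positivity
  -- For `s ≥ 4` one has `s ≤ (s/2)²`. The bound is wanted in `s / 2`, which will be `-log |x|`.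
  have e3 : Real.log s ≤ 2 * Real.log (s / 2) := by
    calc Real.log s ≤ Real.log ((s / 2) ^ 2) := Real.log_le_log hs0 (by nlinarith)
      _ = 2 * Real.log (s / 2) := by rw [Real.log_pow]; norm_num
  have e4 : (s / 2) ^ (p - 1) * s⁻¹ = 1 / 2 * ((s / 2) ^ (2 - p))⁻¹ := by
    rw [← Real.rpow_neg hs2.le, show -(2 - p) = (p - 1) - 1 by ring, Real.rpow_sub_one hs2.ne' (p - 1)]
    generalize (s / 2) ^ (p - 1) = X
    field_simp
  have hsp2 : 0 < (s / 2) ^ (2 - p) := Real.rpow_pos_of_pos hs2 _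
  calc |v s - P ^ p| = |(v s - W s ^ p) + (W s ^ p - P ^ p)| := by ring_nf
    _ ≤ |v s - W s ^ p| + |W s ^ p - P ^ p| := abs_add_le _ _
    _ ≤ D * ((s / 2) ^ (p - 1) * (Real.log s * s⁻¹)) := by rw [hD]; linarith
    _ = D * (Real.log s * ((s / 2) ^ (p - 1) * s⁻¹)) := by ring
    _ = 1 / 2 * D * (Real.log s * ((s / 2) ^ (2 - p))⁻¹) := by rw [e4]; ring
    _ ≤ 1 / 2 * D * (2 * Real.log (s / 2) * ((s / 2) ^ (2 - p))⁻¹) := by gcongr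
    _ = D * (Real.log (s / 2) / (s / 2) ^ (2 - p)) := by ring

theorem tendsto_neg_log_norm_sq :
    Filter.Tendsto (fun x : Plane => -Real.log (‖x‖ ^ 2)) (𝓝[≠] 0) Filter.atTop := by
  have h1 : Filter.Tendsto (fun x : Plane => ‖x‖ ^ 2) (𝓝[≠] 0) (𝓝[>] 0) := by
    refine tendsto_nhdsWithin_iff.2 ⟨?_, ?_⟩
    · have : Continuous fun x : Plane => ‖x‖ ^ 2 := by fun_prop
      have h := this.tendsto 0
      simp only [norm_zero, ne_eq, OfNat.ofNat_ne_zero, not_false_eq_true, zero_pow] at h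
      exact h.mono_left nhdsWithin_le_nhds
    · filter_upwards [self_mem_nhdsWithin] with x hx
      have : 0 < ‖x‖ := norm_pos_iff.2 hx
      exact pow_pos this 2
  exact Filter.tendsto_neg_atBot_atTop.comp (Real.tendsto_log_nhdsGT_zero.comp h1)

theorem corollary2p1 :
    (∀ q r : ℝ, 1 < q →
      ∃ (R : ℝ) (u : Plane → ℝ),
        IsSingularSolution (fun s => s ^ r * Real.exp (s ^ q)) R u ∧
        (∀ x ∈ puncturedDisc R, 0 < u x) ∧
        ContDiffOn ℝ ∞ u (puncturedDisc R) ∧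
        (∀ x ∈ puncturedDisc R, ∀ y ∈ puncturedDisc R, ‖x‖ = ‖y‖ → u x = u y) ∧
        (fun x => u x - singularProfile q r x) =O[𝓝[≠] (0 : Plane)] remainderOrder q) ∧
    (∀ x : Plane, 0 < ‖x‖ → ‖x‖ < 1 →
      singularProfile 2 1 x =
          (-2 * Real.log ‖x‖ - 2 * Real.log (-Real.log ‖x‖) - 2 * Real.log 2) ^ (1 / 2 : ℝ) ∧
        remainderOrder 2 x = Real.log (-Real.log ‖x‖) / (-Real.log ‖x‖) ^ (3 / 2 : ℝ)) := by
  constructor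
  · intro q r hq
    have hq0 : 0 < q := by linarith
    obtain ⟨T, C, W, v, v₁, hT, hWtop, hv⟩ := exists_solution_near_inverse_profile r hq
    have hpos : ∀ s, T < s → 0 < v s := by
      intro s hs
      obtain ⟨-, h2, -, h4, -⟩ := hv s hs
      have : 0 < W s ^ (1 / q) := Real.rpow_pos_of_pos (by linarith) _
      linarith
    have hvsm : ContDiffOn ℝ ∞ v (Set.Ioi T) := contDiffOn_of_hasDerivAt_nonlinearity
      (fun s hs => (hv s hs).2.2.2.2.1) (fun s hs => (hv s hs).2.2.2.2.2.1) hpos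
    -- The radius `exp (-T/2)` is the one for which `|x| < R` means `s > T`.
    have hmem : ∀ x ∈ puncturedDisc (Real.exp (-T / 2)), 0 < ‖x‖ ∧ T < -Real.log (‖x‖ ^ 2) := by
      intro x hx
      have hx0 : 0 < ‖x‖ := norm_pos_iff.2 hx.2
      have hxR : ‖x‖ < Real.exp (-T / 2) := mem_ball_zero_iff.1 hx.1
      have h1 := Real.log_lt_log hx0 hxR
      rw [Real.log_exp] at h1
      refine ⟨hx0, ?_⟩
      rw [Real.log_pow]
      push_cast
      linarith
    have husm : ContDiffOn ℝ ∞ (fun x : Plane => v (-Real.log (‖x‖ ^ 2)))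
        (puncturedDisc (Real.exp (-T / 2))) := by
      refine hvsm.comp (t := Set.Ioi T) ?_ (fun x hx => (hmem x hx).2)
      exact ((contDiff_norm_sq ℝ).contDiffOn.log
        (fun x hx => (pow_pos (hmem x hx).1 2).ne')).neg
    refine ⟨Real.exp (-T / 2), fun x => v (-Real.log (‖x‖ ^ 2)), ⟨Real.exp_pos _,
      contDiffOn_infty.1 husm 2, fun x hx => (hpos _ (hmem x hx).2).le, ?_, ?_⟩,
      fun x hx => hpos _ (hmem x hx).2, husm, fun x _ y _ hxy => by beta_reduce; rw [hxy], ?_⟩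
    · intro x hx
      obtain ⟨hx0, hxT⟩ := hmem x hx
      have hρ0 : 0 < ‖x‖ ^ 2 := pow_pos hx0 2
      have hlog : ∀ ρ : ℝ, 0 < ρ → HasDerivAt (fun ρ => -Real.log ρ) (-ρ⁻¹) ρ :=
        fun ρ hρ => (Real.hasDerivAt_log hρ.ne').neg
      have hev : ∀ᶠ ρ in 𝓝 (‖x‖ ^ 2), HasDerivAt (fun ρ => v (-Real.log ρ))
          (v₁ (-Real.log ρ) * (-ρ⁻¹)) ρ := by
        filter_upwards [Ioi_mem_nhds hρ0,
          (hlog _ hρ0).continuousAt.eventually (Ioi_mem_nhds hxT)] with ρ h1 h2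
        exact (hv _ h2).2.2.2.2.1.comp ρ (hlog ρ h1)
      have hφ := (HasDerivAt.comp (h := fun ρ => -Real.log ρ) (‖x‖ ^ 2)
        (hv _ hxT).2.2.2.2.2.1 (hlog _ hρ0)).mul (hasDerivAt_inv hρ0.ne').neg
      -- For `f ρ = v (-log ρ)` the first-order terms cancel, leaving `4 v'' / ρ`; the factor
      -- `e^{-s} = ρ` in `v''` removes the denominator.
      rw [laplacian_comp_norm_sq hev hφ, neg_neg, Real.exp_log hρ0]
      simp only [Function.comp_apply, Pi.neg_apply]
      field_simp
      ring
    · have h1 : Filter.Tendsto v Filter.atTop Filter.atTop := by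
        refine Filter.tendsto_atTop_mono' _ (f₁ := fun s => W s ^ (1 / q) / 2) ?_ ?_
        · filter_upwards [Filter.eventually_gt_atTop T] with s hs using (hv s hs).2.2.2.1
        · exact ((tendsto_rpow_atTop (by positivity)).comp hWtop).atTop_div_const (by norm_num)
      exact h1.comp tendsto_neg_log_norm_sq
    · obtain ⟨D, hD⟩ := exists_eventually_abs_sub_profile_le (v := v) (W := W) (C := C) hq
        ((Filter.eventually_gt_atTop T).mono fun s hs =>
          ⟨(hv s hs).1, (hv s hs).2.1, (hv s hs).2.2.1, (hv s hs).2.2.2.2.2.2⟩)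
      refine Asymptotics.IsBigO.of_bound |D| ?_
      filter_upwards [tendsto_neg_log_norm_sq.eventually hD] with x hx
      have e1 : Real.log (1 / ‖x‖ ^ 2) = -Real.log (‖x‖ ^ 2) := by
        rw [one_div, Real.log_inv]
      have e2 : -Real.log (‖x‖ ^ 2) / 2 = -Real.log ‖x‖ := by
        rw [Real.log_pow]; push_cast; ring
      rw [e2] at hx
      rw [singularProfile, e1, remainderOrder, Real.norm_eq_abs, ← Real.norm_eq_abs D, ← norm_mul]
      exact hx.trans (le_abs_self _)
  · intro x hx0 hx1
    have hL : Real.log ‖x‖ < 0 := Real.log_neg hx0 hx1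
    have e1 : Real.log (1 / ‖x‖ ^ 2) = 2 * -Real.log ‖x‖ := by
      rw [one_div, Real.log_inv, Real.log_pow]; push_cast; ring
    constructor
    · rw [singularProfile, e1, Real.log_mul (by norm_num) (by linarith)]
      norm_num
      congr 1
      ring
    · rw [remainderOrder]
      norm_num
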